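/- Let $\mathbf S$ be the symmetric groupoid: its objects are the natural numbers, its morphisms $m\to n$ are the bijections $\{1,\dots,m\}\to\{1,\dots,n\}$, and it is strict symmetric monoidal with $m\otimes n=m+n$, with $\sigma+\tau$ acting by $\sigma$ on the first block and by (shifted) $\tau$ on the second, and with the block transpositions as braiding. Let $\mathbf{Mon}$ be the category of monoids with its cartesian symmetric monoidal structure. A *one-colored network model* is a lax symmetric monoidal functor $F\colon\mathbf S\to\mathbf{Mon}$. Write $\cup$ for the product and $e_n$ for the unit of the monoid $F(n)$, $\sigma g$ for $F(\sigma)(g)$, and $\sqcup\colon F(m)\times F(n)\to F(m+n)$ for the lax structure map; an empty disjoint union is $e_0$. Regard monoids as one-object categories and let $\int F$ be the Grothendieck construction of $F$: its objects are the natural numbers, a morphism $m\to n$ is a pair $(\sigma,g)$ of a bijection $\sigma\colon m\to n$ in $\mathbf S$ and an element $g\in F(n)$, composition is $(\sigma,g)\circ(\sigma',g')=(\sigma\sigma',g\cup\sigma g')$, the tensor product is $(\sigma,g)\otimes(\sigma',g')=(\sigma+\sigma',g\sqcup g')$, and the braiding is $(B_{m,n},e_{m+n})$ with $B_{m,n}$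 the braiding of $\mathbf S$. The *network operad* $\mathrm O_F=\mathrm{op}(\int F)$ has the set of types $\mathbb N$, operations $\mathrm O_F(n_1,\dots,n_k;n)=\hom_{\int F}(n_1\otimes\cdots\otimes n_k,n)$, composition $f\circ(f_1,\dots,f_k)=f\circ(f_1\otimes\cdots\otimes f_k)$, identity morphisms as identity operations, and for $\tau\in S_k$ the right action $\mathrm O_F(n_1,\dots,n_k;n)\to\mathrm O_F(n_{\tau(1)},\dots,n_{\tau(k)};n)$ by precomposition with the morphism $n_{\tau(1)}\otimes\cdots\otimes n_{\tau(k)}\to n_1\otimes\cdots\otimes n_k$ that permutes the factors and is built from the braiding. **Theorem.** Let $F$ be a one-colored network model. Then $\mathrm O_F$ is an $\mathbb N$-typed operad (that is, composition is associative and unital, the symmetric groups act from the right, and composition is equivariant), and the following hold for all $k\ge 0$ and $n_1,\dots,n_k,n\in\mathbb N$. 1. The sets of operations are $$\mathrm O_F(n_1,\dots,n_k;n)=\begin{cases}S_n\times F(n)&\text{if }n_1+\cdots+n_k=n,\\ \emptyset&\text{otherwise,}\end{cases}$$ where $(\sigma,g)\in S_n\times F(n)$ is identified with the morphism $(\sigma,g)\colon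 n_1+\cdots+n_k=n\to n$ of $\int F$. 2. If $(\sigma,g)\in S_n\times F(n)=\mathrm O_F(n_1,\dots,n_k;n)$ and $(\tau_i,h_i)\in S_{n_i}\times F(n_i)=\mathrm O_F(n_{i1},\dots,n_{ij_i};n_i)$ for $1\le i\le k$, then $$(\sigma,g)\circ\big((\tau_1,h_1),\dots,(\tau_k,h_k)\big)=\big(\sigma(\tau_1+\cdots+\tau_k),\;g\cup\sigma(h_1\sqcup\cdots\sqcup h_k)\big).$$ 3. The identity operation in $\mathrm O_F(n;n)$ is $(1,e_n)$. 4. For $(\sigma,g)\in\mathrm O_F(n_1,\dots,n_k;n)$ with $n_1+\cdots+n_k=n$ and $\tau\in S_k$, the right action is $$(\sigma,g)\,\tau=(\sigma\,\bar\tau,\,g)\in\mathrm O_F(n_{\tau(1)},\dots,n_{\tau(k)};n),$$ where $\bar\tau\in S_n$ is the block permutation given by $\tau$: it maps the $i$-th block of $n=n_{\tau(1)}+\cdots+n_{\tau(k)}$ onto the $\tau(i)$-th block of $n=n_1+\cdots+n_k$, preserving the order within each block. -/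

import Mathlib

open CategoryTheory MonoidalCategory Limits

universe u v w

namespace NetworkOperad

noncomputable section Mon

/-- The product of two monoids, as a categorical product. -/
def binaryProductLimitCone (M N : MonCat.{u}) : LimitCone (pair M N) where
  cone := BinaryFan.mk (MonCat.ofHom (MonoidHom.fst M N)) (MonCat.ofHom (MonoidHom.snd M N))
  isLimit := BinaryFan.IsLimit.mk _ (fun l r => MonCat.ofHom (MonoidHom.prod l.hom r.hom))
    (fun _ _ => rfl) (fun _ _ => rfl) (fun l r m h₁ h₂ => by
      subst h₁ h₂
      rfl)

def isTerminalPUnit : IsTerminal (MonCat.of PUnit.{u + 1}) :=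
  IsTerminal.ofUniqueHom (fun _ => MonCat.ofHom 1) (fun _ _ => rfl)

/-- `Mon` is monoidal under the cartesian product `M × N` of monoids. -/
instance monCartesian : CartesianMonoidalCategory MonCat.{u} :=
  .ofChosenFiniteProducts ⟨_, isTerminalPUnit⟩ binaryProductLimitCone

instance monBraided : BraidedCategory MonCat.{u} := .ofCartesianMonoidalCategory

end Mon

section Symm

/-- The symmetric groupoid: objects are natural numbers, and a morphism from `m` to `n` is a
bijection `{1, …, m} → {1, …, n}`. -/
@[ext]
structure SymGpd : Type where
  size : ℕ

namespace SymGpd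

/-- Morphisms of the symmetric groupoid. -/
@[ext]
structure Hom (m n : SymGpd) : Type where
  toEquiv : Fin m.size ≃ Fin n.size

instance : Category SymGpd where
  Hom := Hom
  id m := ⟨Equiv.refl _⟩
  comp f g := ⟨f.toEquiv.trans g.toEquiv⟩

/-- A bijection as a morphism of the symmetric groupoid. -/
def ofEquiv {m n : ℕ} (e : Fin m ≃ Fin n) : (⟨m⟩ : SymGpd) ⟶ ⟨n⟩ := ⟨e⟩

@[simp] theorem id_toEquiv (m : SymGpd) : Hom.toEquiv (𝟙 m) = Equiv.refl _ := rfl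

@[simp] theorem comp_toEquiv {l m n : SymGpd} (f : l ⟶ m) (g : m ⟶ n) :
    Hom.toEquiv (f ≫ g) = f.toEquiv.trans g.toEquiv := rfl

@[ext] theorem hom_ext {m n : SymGpd} {f g : m ⟶ n} (h : ∀ i, f.toEquiv i = g.toEquiv i) :
    f = g := Hom.ext (Equiv.ext h)

end SymGpd

/-- The sum `σ + τ` of two bijections: it acts by `σ` on the first block, and by `τ`, shifted, on
the second block. -/
def plus {m m' n n' : ℕ} (σ : Fin m ≃ Fin m') (τ : Fin n ≃ Fin n') : Fin (m + n) ≃ Fin (m' + n') :=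
  finSumFinEquiv.symm.trans ((Equiv.sumCongr σ τ).trans finSumFinEquiv)

@[simp] theorem plus_castAdd {m m' n n' : ℕ} (σ : Fin m ≃ Fin m') (τ : Fin n ≃ Fin n')
    (i : Fin m) : plus σ τ (Fin.castAdd n i) = Fin.castAdd n' (σ i) := by
  simp [plus]

@[simp] theorem plus_natAdd {m m' n n' : ℕ} (σ : Fin m ≃ Fin m') (τ : Fin n ≃ Fin n')
    (i : Fin n) : plus σ τ (Fin.natAdd m i) = Fin.natAdd m' (τ i) := by
  simp [plus]

namespace SymGpd

/-- The strict monoidal structure on the symmetric groupoid. -/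
instance : MonoidalCategoryStruct SymGpd where
  tensorObj m n := ⟨m.size + n.size⟩
  tensorUnit := ⟨0⟩
  tensorHom f g := ⟨plus f.toEquiv g.toEquiv⟩
  whiskerLeft m _ _ f := ⟨plus (Equiv.refl _) f.toEquiv⟩
  whiskerRight f n := ⟨plus f.toEquiv (Equiv.refl _)⟩
  associator l m n :=
    { hom := ⟨finCongr (Nat.add_assoc _ _ _)⟩
      inv := ⟨finCongr (Nat.add_assoc _ _ _).symm⟩ }
  leftUnitor n :=
    { hom := ⟨finCongr (Nat.zero_add _)⟩
      inv := ⟨finCongr (Nat.zero_add _).symm⟩ }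
  rightUnitor n :=
    { hom := ⟨finCongr (Nat.add_zero _)⟩
      inv := ⟨finCongr (Nat.add_zero _).symm⟩ }

@[simp] theorem tensorObj_size (m n : SymGpd) : (m ⊗ n).size = m.size + n.size := rfl
@[simp] theorem tensorUnit_size : (𝟙_ SymGpd).size = 0 := rfl
@[simp] theorem tensorHom_toEquiv {m m' n n' : SymGpd} (f : m ⟶ m') (g : n ⟶ n') :
    Hom.toEquiv (f ⊗ₘ g) = plus f.toEquiv g.toEquiv := rfl
@[simp] theorem whiskerLeft_toEquiv (m : SymGpd) {n n' : SymGpd} (g : n ⟶ n') :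
    Hom.toEquiv (m ◁ g) = plus (Equiv.refl _) g.toEquiv := rfl
@[simp] theorem whiskerRight_toEquiv {m m' : SymGpd} (f : m ⟶ m') (n : SymGpd) :
    Hom.toEquiv (f ▷ n) = plus f.toEquiv (Equiv.refl _) := rfl
@[simp] theorem associator_hom_toEquiv (l m n : SymGpd) :
    Hom.toEquiv (α_ l m n).hom = finCongr (Nat.add_assoc _ _ _) := rfl
@[simp] theorem associator_inv_toEquiv (l m n : SymGpd) :
    Hom.toEquiv (α_ l m n).inv = finCongr (Nat.add_assoc _ _ _).symm := rfl
@[simp] theorem leftUnitor_hom_toEquiv (n : SymGpd) :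
    Hom.toEquiv (λ_ n).hom = finCongr (Nat.zero_add _) := rfl
@[simp] theorem rightUnitor_hom_toEquiv (n : SymGpd) :
    Hom.toEquiv (ρ_ n).hom = finCongr (Nat.add_zero _) := rfl

theorem plus_val {m m' n n' : ℕ} (σ : Fin m ≃ Fin m') (τ : Fin n ≃ Fin n') (i : Fin (m + n)) :
    (plus σ τ i : ℕ) = if h : i.val < m then (σ ⟨i, h⟩).val
      else m' + (τ ⟨i - m, by omega⟩).val := by
  refine Fin.addCases (fun j => ?_) (fun j => ?_) i <;> simp

instance : MonoidalCategory SymGpd := MonoidalCategory.ofTensorHom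
  (id_tensorHom_id := fun X Y => by
    ext i; refine Fin.addCases (fun j => ?_) (fun j => ?_) i <;> simp)
  (id_tensorHom := fun _ _ _ _ => rfl)
  (tensorHom_id := fun _ _ => rfl)
  (tensorHom_comp_tensorHom := fun _ _ _ _ => by
    ext i; refine Fin.addCases (fun j => ?_) (fun j => ?_) i <;> simp)
  (associator_naturality := fun {X₁ X₂ X₃ Y₁ Y₂ Y₃} f₁ f₂ f₃ => by
    ext i
    simp only [comp_toEquiv, tensorHom_toEquiv, Equiv.trans_apply, associator_hom_toEquiv,
      finCongr_apply, Fin.val_cast, plus_val, tensorObj_size]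
    split_ifs <;> first | omega | simp [Nat.sub_sub, Nat.add_assoc])
  (leftUnitor_naturality := fun f => by
    ext i; simp [plus_val]; rfl)
  (rightUnitor_naturality := fun f => by
    ext i
    exact congrArg Fin.val (plus_castAdd (n' := 0) _ (Equiv.refl (Fin 0)) i))
  (pentagon := fun _ _ _ _ => by
    ext i
    simp [plus_val]
    split_ifs <;> omega)
  (triangle := fun X Y => by
    ext i
    refine Fin.addCases (fun j => Fin.addCases (fun k => ?_) (fun k => k.elim0) j)
      (fun j => ?_) i
    · simp [plus_val]
    · simp)

theorem finAddFlip_val {m n : ℕ} (i : Fin (m + n)) :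
    (finAddFlip i : ℕ) = if i.val < m then n + i.val else i.val - m := by
  refine Fin.addCases (fun j => ?_) (fun j => ?_) i <;> simp

/-- The symmetry of the symmetric groupoid: the block permutation `B_{m,n}` that swaps the first
`m` with the last `n` elements. -/
instance : BraidedCategory SymGpd where
  braiding m n :=
    { hom := ⟨finAddFlip⟩
      inv := ⟨finAddFlip⟩
      hom_inv_id := by
        ext i; refine Fin.addCases (fun j => ?_) (fun j => ?_) i <;> simp
      inv_hom_id := by
        ext i; refine Fin.addCases (fun j => ?_) (fun j => ?_) i <;> simp }
  braiding_naturality_left f Z := by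
    ext i; refine Fin.addCases (fun j => ?_) (fun j => ?_) i <;> simp
  braiding_naturality_right X _ _ f := by
    ext i; refine Fin.addCases (fun j => ?_) (fun j => ?_) i <;> simp
  hexagon_forward X Y Z := by
    ext i
    simp only [comp_toEquiv, whiskerLeft_toEquiv, whiskerRight_toEquiv, Equiv.trans_apply,
      associator_hom_toEquiv, finCongr_apply, Fin.val_cast, plus_val, tensorObj_size,
      finAddFlip_val, Equiv.refl_apply]
    split_ifs <;> omega
  hexagon_reverse X Y Z := by
    ext i
    simp only [comp_toEquiv, whiskerLeft_toEquiv, whiskerRight_toEquiv, Equiv.trans_apply,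
      associator_inv_toEquiv, finCongr_apply, Fin.val_cast, plus_val, tensorObj_size,
      finAddFlip_val, Equiv.refl_apply]
    split_ifs <;> omega

@[simp] theorem braiding_hom_toEquiv (m n : SymGpd) :
    Hom.toEquiv (β_ m n).hom = finAddFlip := rfl

instance : SymmetricCategory SymGpd where
  symmetry m n := by
    ext i; refine Fin.addCases (fun j => ?_) (fun j => ?_) i <;> simp

end SymGpd
end Symm

section Groth

variable {C : Type v} [Category.{w} C]

/-- The Grothendieck construction of a functor into monoids (one-object categories): an object is
an object of `C` together with the unique object of the category `F c`. -/
structure Groth (F : C ⥤ MonCat.{u}) : Type v where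
  base : C

namespace Groth

variable {F : C ⥤ MonCat.{u}}

/-- A morphism `(c, ∗) ⟶ (d, ∗)` is a pair of a morphism `f : c ⟶ d` of `C` and a morphism
`F f ∗ ⟶ ∗` in `F d`, that is, an element of the monoid `F d`. -/
@[ext]
structure Hom (X Y : Groth F) where
  base : X.base ⟶ Y.base
  elem : F.obj Y.base

/-- Composition is `(f, g) ∘ (f', g') = (f ∘ f', g · F f (g'))`. -/
instance : Category (Groth F) where
  Hom := Hom
  id X := ⟨𝟙 X.base, 1⟩
  comp f' f := ⟨f'.base ≫ f.base, f.elem * F.map f.base f'.elem⟩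
  id_comp f := by
    apply Hom.ext <;> simp
  comp_id f := by
    apply Hom.ext <;> simp
  assoc f g h := by
    apply Hom.ext <;> simp [mul_assoc]

@[simp] theorem id_base (X : Groth F) : Hom.base (𝟙 X) = 𝟙 X.base := rfl
@[simp] theorem id_elem (X : Groth F) : Hom.elem (𝟙 X) = 1 := rfl
@[simp] theorem comp_base {X Y Z : Groth F} (f : X ⟶ Y) (g : Y ⟶ Z) :
    Hom.base (f ≫ g) = f.base ≫ g.base := rfl
@[simp] theorem comp_elem {X Y Z : Groth F} (f : X ⟶ Y) (g : Y ⟶ Z) :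
    Hom.elem (f ≫ g) = g.elem * F.map g.base f.elem := rfl

@[ext] theorem hom_ext {X Y : Groth F} {f g : X ⟶ Y} (hb : f.base = g.base)
    (he : f.elem = g.elem) : f = g := Hom.ext hb he

/-- The isomorphism `(e, 1)`. -/
@[simps]
def mkIso {X Y : Groth F} (e : X.base ≅ Y.base) : X ≅ Y where
  hom := ⟨e.hom, 1⟩
  inv := ⟨e.inv, 1⟩
  hom_inv_id := by ext <;> simp
  inv_hom_id := by ext <;> simp

end Groth

end Groth

noncomputable section GrothMon

open Functor.LaxMonoidal

variable {C : Type v} [Category.{w} C] [MonoidalCategory C]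

/-- The structure map `F c × F d → F (c ⊗ d)` of a lax monoidal functor into monoids. -/
def lax (F : C ⥤ MonCat.{u}) [F.LaxMonoidal] {X Y : C} (g : F.obj X) (h : F.obj Y) :
    F.obj (X ⊗ Y) :=
  (μ F X Y).hom ((g, h) : F.obj X × F.obj Y)

variable {F : C ⥤ MonCat.{u}}

section
variable [F.LaxMonoidal]

theorem lax_one {X Y : C} : lax F (1 : F.obj X) (1 : F.obj Y) = 1 :=
  (μ F X Y).hom.map_one

theorem lax_mul {X Y : C} (g g' : F.obj X) (h h' : F.obj Y) :
    lax F (g * g') (h * h') = lax F g h * lax F g' h' :=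
  (μ F X Y).hom.map_mul ((g, h) : F.obj X × F.obj Y) ((g', h') : F.obj X × F.obj Y)

theorem lax_natural {X X' Y Y' : C} (f : X ⟶ X') (f' : Y ⟶ Y') (g : F.obj X) (h : F.obj Y) :
    F.map (f ⊗ₘ f') (lax F g h) = lax F (F.map f g) (F.map f' h) :=
  (ConcreteCategory.congr_hom (μ_natural F f f') ((g, h) : F.obj X × F.obj Y)).symm

theorem lax_assoc {X Y Z : C} (g : F.obj X) (h : F.obj Y) (k : F.obj Z) :
    F.map (α_ X Y Z).hom (lax F (lax F g h) k) = lax F g (lax F h k) :=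
  ConcreteCategory.congr_hom (Functor.LaxMonoidal.associativity F X Y Z)
    (((g, h), k) : (F.obj X × F.obj Y) × F.obj Z)

theorem lax_unit_left {X : C} (g : F.obj X) :
    F.map (λ_ X).hom (lax F (1 : F.obj (𝟙_ C)) g) = g := by
  have := ConcreteCategory.congr_hom (left_unitality F X) ((PUnit.unit, g) : PUnit × F.obj X)
  refine Eq.trans ?_ this.symm
  change _ = F.map (λ_ X).hom (lax F ((ε F).hom 1) g)
  rw [map_one]

theorem lax_unit_right {X : C} (g : F.obj X) :
    F.map (ρ_ X).hom (lax F g (1 : F.obj (𝟙_ C))) = g := by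
  have := ConcreteCategory.congr_hom (right_unitality F X) ((g, PUnit.unit) : F.obj X × PUnit)
  refine Eq.trans ?_ this.symm
  change _ = F.map (ρ_ X).hom (lax F g ((ε F).hom 1))
  rw [map_one]

end

theorem lax_braid [BraidedCategory C] [F.LaxBraided] {X Y : C} (g : F.obj X) (h : F.obj Y) :
    F.map (β_ X Y).hom (lax F g h) = lax F h g :=
  ConcreteCategory.congr_hom (Functor.LaxBraided.braided (F := F) X Y)
    ((g, h) : F.obj X × F.obj Y)

namespace Groth

variable [F.LaxMonoidal]

/-- The tensor product of morphisms is `(f, g) ⊗ (f', g') = (f ⊗ f', Φ (g, g'))`. -/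
instance : MonoidalCategoryStruct (Groth F) where
  tensorObj X Y := ⟨X.base ⊗ Y.base⟩
  tensorUnit := ⟨𝟙_ C⟩
  tensorHom f g := ⟨f.base ⊗ₘ g.base, lax F f.elem g.elem⟩
  whiskerLeft X _ _ f := ⟨X.base ◁ f.base, lax F 1 f.elem⟩
  whiskerRight f X := ⟨f.base ▷ X.base, lax F f.elem 1⟩
  associator X Y Z := mkIso (α_ X.base Y.base Z.base)
  leftUnitor X := mkIso (λ_ X.base)
  rightUnitor X := mkIso (ρ_ X.base)

@[simp] theorem tensorObj_base (X Y : Groth F) : (X ⊗ Y).base = X.base ⊗ Y.base := rfl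
@[simp] theorem tensorUnit_base : (𝟙_ (Groth F)).base = 𝟙_ C := rfl
@[simp] theorem tensorHom_base {X X' Y Y' : Groth F} (f : X ⟶ X') (g : Y ⟶ Y') :
    Hom.base (f ⊗ₘ g) = f.base ⊗ₘ g.base := rfl
@[simp] theorem tensorHom_elem {X X' Y Y' : Groth F} (f : X ⟶ X') (g : Y ⟶ Y') :
    Hom.elem (f ⊗ₘ g) = lax F f.elem g.elem := rfl
@[simp] theorem whiskerLeft_base (X : Groth F) {Y Y' : Groth F} (g : Y ⟶ Y') :
    Hom.base (X ◁ g) = X.base ◁ g.base := rfl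
@[simp] theorem whiskerLeft_elem (X : Groth F) {Y Y' : Groth F} (g : Y ⟶ Y') :
    Hom.elem (X ◁ g) = lax F (1 : F.obj X.base) g.elem := rfl
@[simp] theorem whiskerRight_base {X X' : Groth F} (f : X ⟶ X') (Y : Groth F) :
    Hom.base (f ▷ Y) = f.base ▷ Y.base := rfl
@[simp] theorem whiskerRight_elem {X X' : Groth F} (f : X ⟶ X') (Y : Groth F) :
    Hom.elem (f ▷ Y) = lax F f.elem (1 : F.obj Y.base) := rfl
@[simp] theorem associator_eq (X Y Z : Groth F) :
    α_ X Y Z = mkIso (α_ X.base Y.base Z.base) := rfl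
@[simp] theorem leftUnitor_eq (X : Groth F) : λ_ X = mkIso (λ_ X.base) := rfl
@[simp] theorem rightUnitor_eq (X : Groth F) : ρ_ X = mkIso (ρ_ X.base) := rfl

instance : MonoidalCategory (Groth F) := MonoidalCategory.ofTensorHom
  (id_tensorHom_id := fun X Y => by ext <;> simp [lax_one])
  (id_tensorHom := fun _ _ _ _ => by ext <;> simp)
  (tensorHom_id := fun _ _ => by ext <;> simp)
  (tensorHom_comp_tensorHom := fun _ _ _ _ => by
    ext <;> simp [lax_mul, lax_natural])
  (associator_naturality := fun _ _ _ => by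
    ext <;> simp [lax_assoc])
  (leftUnitor_naturality := fun f => by
    ext
    · simp
    · simpa using lax_unit_left _)
  (rightUnitor_naturality := fun f => by
    ext
    · simp
    · simpa using lax_unit_right _)
  (pentagon := fun _ _ _ _ => by
    ext <;> simp [lax_one])
  (triangle := fun _ _ => by
    ext <;> simp [lax_one])

end Groth

namespace Groth

instance [BraidedCategory C] [F.LaxBraided] : BraidedCategory (Groth F) where
  braiding X Y := mkIso (β_ X.base Y.base)
  braiding_naturality_left f Z := by
    ext <;> simp [lax_braid]
  braiding_naturality_right X _ _ f := by
    ext <;> simp [lax_braid]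
  hexagon_forward X Y Z := by
    ext <;> simp [lax_one]
  hexagon_reverse X Y Z := by
    ext <;> simp [lax_one]

@[simp] theorem braiding_eq [BraidedCategory C] [F.LaxBraided] (X Y : Groth F) :
    β_ X Y = mkIso (β_ X.base Y.base) := rfl

instance [SymmetricCategory C] [F.LaxBraided] : SymmetricCategory (Groth F) where
  symmetry X Y := by
    ext <;> simp

end Groth
end GrothMon

section Profiles

variable {T : Type v}

/-- The concatenation `b₁₁, …, b₁ⱼ₁, …, bₖ₁, …, bₖⱼₖ` of a tuple of tuples. -/
def flat {k : ℕ} {j : Fin k → ℕ} (b : ∀ i, Fin (j i) → T) : Fin (∑ i, j i) → T :=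
  fun p => b (finSigmaFinEquiv.symm p).1 (finSigmaFinEquiv.symm p).2

theorem finSigmaFinEquiv_zero_val {k : ℕ} {j : Fin (k + 1) → ℕ} (a : Fin (j 0)) :
    (finSigmaFinEquiv (⟨0, a⟩ : (i : Fin (k + 1)) × Fin (j i)) : ℕ) = a := by
  simp

theorem finSigmaFinEquiv_succ_val {k : ℕ} {j : Fin (k + 1) → ℕ} (i : Fin k)
    (a : Fin (j i.succ)) :
    (finSigmaFinEquiv (⟨i.succ, a⟩ : (i : Fin (k + 1)) × Fin (j i)) : ℕ) =
      j 0 + (finSigmaFinEquiv (⟨i, a⟩ : (i : Fin k) × Fin (j i.succ)) : ℕ) := by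
  rw [finSigmaFinEquiv_apply, finSigmaFinEquiv_apply, ← Nat.add_assoc]
  congr 1
  exact Fin.sum_univ_succ (n := i.val) _

theorem flat_apply {k : ℕ} {j : Fin k → ℕ} (b : ∀ i, Fin (j i) → T) (i : Fin k)
    (a : Fin (j i)) : flat b (finSigmaFinEquiv ⟨i, a⟩) = b i a := by
  simp only [flat]
  rw [Equiv.symm_apply_apply]

theorem flat_succ {k : ℕ} {j : Fin (k + 1) → ℕ} (b : ∀ i, Fin (j i) → T)
    (p : Fin (∑ i, j i)) :
    flat b p =
      Fin.append (b 0) (flat fun i => b i.succ) (Fin.cast (Fin.sum_univ_succ j) p) := by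
  obtain ⟨⟨i, a⟩, rfl⟩ := finSigmaFinEquiv.surjective p
  rw [flat_apply]
  induction i using Fin.cases with
  | zero =>
    have : Fin.cast (Fin.sum_univ_succ j) (finSigmaFinEquiv ⟨0, a⟩) = Fin.castAdd _ a :=
      Fin.ext (finSigmaFinEquiv_zero_val a)
    rw [this, Fin.append_left]
  | succ i =>
    have : Fin.cast (Fin.sum_univ_succ j) (finSigmaFinEquiv ⟨i.succ, a⟩) =
        Fin.natAdd _ (finSigmaFinEquiv ⟨i, a⟩) :=
      Fin.ext (finSigmaFinEquiv_succ_val i a)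
    rw [this, Fin.append_right, flat_apply]

theorem append_succ {m n : ℕ} (u : Fin (m + 1) → T) (v : Fin n → T) (p : Fin (m + 1 + n)) :
    Fin.append u v p = (Fin.cons (u 0) (Fin.append (fun i => u i.succ) v) : Fin (m + n + 1) → T)
      (Fin.cast (Nat.add_right_comm m 1 n) p) := by
  refine Fin.addCases (fun i => ?_) (fun i => ?_) p
  · rw [Fin.append_left]
    induction i using Fin.cases with
    | zero => rfl
    | succ i =>
      have : Fin.cast (Nat.add_right_comm m 1 n) (Fin.castAdd n i.succ) =
          (Fin.castAdd n i).succ := Fin.ext rfl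
      rw [this, Fin.cons_succ, Fin.append_left]
  · have : Fin.cast (Nat.add_right_comm m 1 n) (Fin.natAdd (m + 1) i) =
        (Fin.natAdd m i).succ := Fin.ext (by simp; omega)
    rw [Fin.append_right, this, Fin.cons_succ, Fin.append_right]

end Profiles

section Perms

open Equiv

/-- The sum `τ₁ + ⋯ + τₖ` of permutations, by iterating the binary sum. -/
def blockSum : {k : ℕ} → {n : Fin k → ℕ} → (∀ i, Perm (Fin (n i))) → Perm (Fin (∑ i, n i))
  | 0, _, _ => 1
  | _ + 1, n, τ => (finCongr (Fin.sum_univ_succ n).symm).permCongr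
      (plus (τ 0) (blockSum fun i => τ i.succ))

/-- The bijection from `n_{τ(1)} + ⋯ + n_{τ(k)}` to `n₁ + ⋯ + nₖ` that maps the `i`-th block of
the source onto the `τ(i)`-th block of the target, in order. -/
def blockEquiv {k : ℕ} (n : Fin k → ℕ) (τ : Perm (Fin k)) :
    Fin (∑ i, n (τ i)) ≃ Fin (∑ i, n i) :=
  finSigmaFinEquiv.symm.trans
    ((Equiv.sigmaCongrLeft (β := fun i => Fin (n i)) τ).trans finSigmaFinEquiv)

theorem sum_perm {k : ℕ} {n : Fin k → ℕ} {N : ℕ} (h : ∑ i, n i = N) (τ : Perm (Fin k)) :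
    ∑ i, n (τ i) = N :=
  (Equiv.sum_comp τ n).trans h

/-- The block permutation of `N = n₁ + ⋯ + nₖ` that is given by `τ ∈ Sₖ`. -/
def blockPerm {k : ℕ} {n : Fin k → ℕ} {N : ℕ} (h : ∑ i, n i = N) (τ : Perm (Fin k)) :
    Perm (Fin N) :=
  (finCongr (sum_perm h τ)).symm.trans ((blockEquiv n τ).trans (finCongr h))

/-- For `τ ∈ Sₖ₊₁`, the permutation `τ'` of `k` elements that `τ` induces from the complement of
the first element to the complement of its image. -/
def permTail {k : ℕ} (τ : Perm (Fin (k + 1))) : Perm (Fin k) :=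
  (finSuccAboveEquiv 0).trans
    ((τ.subtypeEquiv (p := fun x => x ≠ 0) (q := fun x => x ≠ τ 0)
      fun _ => τ.injective.ne_iff.symm).trans (finSuccAboveEquiv (τ 0)).symm)

theorem succAbove_permTail {k : ℕ} (τ : Perm (Fin (k + 1))) (i : Fin k) :
    (τ 0).succAbove (permTail τ i) = τ i.succ := by
  have := congrArg Subtype.val ((finSuccAboveEquiv (τ 0)).apply_symm_apply
    ((τ.subtypeEquiv (p := fun x => x ≠ 0) (q := fun x => x ≠ τ 0)
      fun _ => τ.injective.ne_iff.symm) (finSuccAboveEquiv 0 i)))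
  exact this

end Perms

section Operads

open Equiv

/-- The data of a typed operad with set of types `T`: operations, identity operations, composition,
and right actions of the symmetric groups. -/
structure TypedOperadData (T : Type v) where
  /-- The operations `O(c₁, …, cₖ; t)`. -/
  Op : {k : ℕ} → (Fin k → T) → T → Type w
  id : (t : T) → Op (fun _ : Fin 1 => t) t
  comp : {k : ℕ} → {c : Fin k → T} → {t : T} → {j : Fin k → ℕ} → {b : ∀ i, Fin (j i) → T} →
    Op c t → (∀ i, Op (b i) (c i)) → Op (flat b) t
  act : {k : ℕ} → {c : Fin k → T} → {t : T} → Op c t → (τ : Perm (Fin k)) →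
    Op (fun i => c (τ i)) t

/-- The laws of a typed operad. The two sides of some of these equations have profiles that are
equal but not definitionally equal. -/
structure TypedOperadData.IsTypedOperad {T : Type v} (O : TypedOperadData.{v, w} T) : Prop where
  id_comp : ∀ {k : ℕ} {c : Fin k → T} {t : T} (f : O.Op c t),
    HEq (O.comp (O.id t) (fun _ => f)) f
  comp_id : ∀ {k : ℕ} {c : Fin k → T} {t : T} (f : O.Op c t),
    HEq (O.comp f (fun i => O.id (c i))) f
  assoc : ∀ {k : ℕ} {c : Fin k → T} {t : T} {j : Fin k → ℕ} {b : ∀ i, Fin (j i) → T}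
    {l : ∀ i, Fin (j i) → ℕ} {a : ∀ i q, Fin (l i q) → T}
    (f : O.Op c t) (g : ∀ i, O.Op (b i) (c i)) (h : ∀ i q, O.Op (a i q) (b i q)),
    HEq (O.comp (O.comp f g) (fun p => h (finSigmaFinEquiv.symm p).1 (finSigmaFinEquiv.symm p).2))
      (O.comp f (fun i => O.comp (g i) (h i)))
  act_one : ∀ {k : ℕ} {c : Fin k → T} {t : T} (f : O.Op c t), O.act f 1 = f
  act_mul : ∀ {k : ℕ} {c : Fin k → T} {t : T} (f : O.Op c t) (σ τ : Perm (Fin k)),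
    O.act (O.act f σ) τ = O.act f (σ * τ)
  act_comp : ∀ {k : ℕ} {c : Fin k → T} {t : T} {j : Fin k → ℕ} {b : ∀ i, Fin (j i) → T}
    (f : O.Op c t) (g : ∀ i, O.Op (b i) (c i)) (τ : Perm (Fin k)),
    HEq (O.comp (O.act f τ) (fun i => g (τ i))) (O.act (O.comp f g) (blockPerm rfl τ))
  comp_act : ∀ {k : ℕ} {c : Fin k → T} {t : T} {j : Fin k → ℕ} {b : ∀ i, Fin (j i) → T}
    (f : O.Op c t) (g : ∀ i, O.Op (b i) (c i)) (τ : ∀ i, Perm (Fin (j i))),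
    HEq (O.comp f (fun i => O.act (g i) (τ i))) (O.act (O.comp f g) (blockSum τ))

/-- Renaming the types of an operad along a map `φ`. -/
def TypedOperadData.rename {T : Type v} {T' : Type*} (O : TypedOperadData.{v, w} T) (φ : T' → T) :
    TypedOperadData.{_, w} T' where
  Op c t := O.Op (fun i => φ (c i)) (φ t)
  id t := O.id (φ t)
  comp f g := O.comp f g
  act f τ := O.act f τ

variable {C : Type v} [Category.{w} C] [MonoidalCategory C]

/-- The tensor product `c₁ ⊗ (c₂ ⊗ (⋯ ⊗ I))` of a tuple of objects. -/
def tensorTuple : {k : ℕ} → (Fin k → C) → C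
  | 0, _ => 𝟙_ C
  | _ + 1, c => c 0 ⊗ tensorTuple fun i => c i.succ

/-- The tensor product of a tuple of morphisms. -/
def tensorTupleMap : {k : ℕ} → {c d : Fin k → C} → (∀ i, c i ⟶ d i) →
    (tensorTuple c ⟶ tensorTuple d)
  | 0, _, _, _ => 𝟙 _
  | _ + 1, _, _, f => f 0 ⊗ₘ tensorTupleMap fun i => f i.succ

theorem tensorTuple_congr {k k' : ℕ} (h : k = k') {c : Fin k → C} {c' : Fin k' → C}
    (hc : ∀ i, c i = c' (Fin.cast h i)) : tensorTuple c = tensorTuple c' := by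
  subst h
  exact congrArg tensorTuple (funext hc)

/-- The canonical morphism from the tensor product of a concatenation of two tuples, made of
associators and unitors. In a strict monoidal category it is an identity. -/
def appendHom : {m n : ℕ} → (u : Fin m → C) → (v : Fin n → C) →
    (tensorTuple (Fin.append u v) ⟶ tensorTuple u ⊗ tensorTuple v)
  | 0, n, u, v =>
      eqToHom (tensorTuple_congr (Nat.zero_add n) (fun i => by
        rw [Fin.append_left_nil u v rfl]; rfl)) ≫ (λ_ (tensorTuple v)).inv
  | m + 1, n, u, v =>
      eqToHom (tensorTuple_congr (Nat.add_right_comm m 1 n) (append_succ u v)) ≫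
        (u 0 ◁ appendHom (fun i => u i.succ) v) ≫ (α_ _ _ _).inv

/-- The canonical morphism from the tensor product of a concatenation of tuples, made of
associators and unitors. In a strict monoidal category it is an identity. -/
def flatHom : {k : ℕ} → {j : Fin k → ℕ} → (b : ∀ i, Fin (j i) → C) →
    (tensorTuple (flat b) ⟶ tensorTuple fun i => tensorTuple (b i))
  | 0, _, _ => eqToHom (tensorTuple_congr (k' := 0) (c' := Fin.elim0) (by simp)
      (fun i => (Fin.cast (by simp) i : Fin 0).elim0))
  | _ + 1, j, b =>
      eqToHom (tensorTuple_congr (Fin.sum_univ_succ j) (flat_succ b)) ≫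
        appendHom (b 0) (flat fun i => b i.succ) ≫ (_ ◁ flatHom fun i => b i.succ)

section
variable [BraidedCategory C]

/-- The canonical morphism that moves a factor `c_p` from the front to its position `p`, by
braiding it past one factor after the other. -/
def insertHom : {k : ℕ} → (c : Fin (k + 1) → C) → (p : Fin (k + 1)) →
    (c p ⊗ tensorTuple (fun i => c (p.succAbove i)) ⟶ tensorTuple c)
  | 0, c, p => eqToHom (by rw [Fin.eq_zero p]; rfl)
  | k + 1, c, p => Fin.cases
      (motive := fun p => c p ⊗ tensorTuple (fun i => c (p.succAbove i)) ⟶ tensorTuple c)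
      (𝟙 _)
      (fun q => (α_ _ _ _).inv ≫ ((β_ (c q.succ) (c 0)).hom ▷ _) ≫ (α_ _ _ _).hom ≫
        (c 0 ◁ (c q.succ ◁ eqToHom (by simp) ≫ insertHom (fun i => c i.succ) q)))
      p

/-- The canonical morphism `c_{τ(1)} ⊗ ⋯ ⊗ c_{τ(k)} ⟶ c₁ ⊗ ⋯ ⊗ cₖ` that is built from the
braiding and permutes the factors by `τ`. -/
def permHom : {k : ℕ} → (c : Fin k → C) → (τ : Perm (Fin k)) →
    (tensorTuple (fun i => c (τ i)) ⟶ tensorTuple c)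
  | 0, _, _ => 𝟙 _
  | _ + 1, c, τ =>
      (c (τ 0) ◁ (eqToHom (by simp only [succAbove_permTail]) ≫
        permHom (fun i => c ((τ 0).succAbove i)) (permTail τ))) ≫ insertHom c (τ 0)

end

variable (C) in
/-- The operad `op(C)` of a symmetric monoidal category: its types are the objects, its operations
are `Hom(c₁ ⊗ ⋯ ⊗ cₖ, c)`, the composite is `f ∘ (g₁ ⊗ ⋯ ⊗ gₖ)`, and the symmetric groups act
through the braiding. (The canonical morphisms `ρ` and `flatHom` are identities in a strict
monoidal category.) -/
def op [SymmetricCategory C] : TypedOperadData.{v, w} C where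
  Op c t := tensorTuple c ⟶ t
  id t := (ρ_ t).hom
  comp f g := flatHom _ ≫ tensorTupleMap g ≫ f
  act f τ := permHom _ τ ≫ f

end Operads

noncomputable section Network

open Equiv

variable (F : SymGpd ⥤ MonCat.{u})

/-- The action `F(m) → F(n)` of a bijection on networks. -/
def action {m n : ℕ} (σ : Fin m ≃ Fin n) (g : F.obj ⟨m⟩) : F.obj ⟨n⟩ :=
  F.map (SymGpd.ofEquiv σ) g

variable [F.LaxBraided]

/-- The disjoint union `g ⊔ h ∈ F(m + n)` of networks `g ∈ F(m)` and `h ∈ F(n)`. -/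
def disjUnion₂ {m n : ℕ} (g : F.obj ⟨m⟩) (h : F.obj ⟨n⟩) : F.obj ⟨m + n⟩ :=
  lax F g h

/-- The disjoint union `h₁ ⊔ ⋯ ⊔ hₖ ∈ F(n₁ + ⋯ + nₖ)`, by iterating the binary one. -/
def disjUnion : {k : ℕ} → {n : Fin k → ℕ} → (∀ i, F.obj ⟨n i⟩) → F.obj ⟨∑ i, n i⟩
  | 0, _, _ => 1
  | _ + 1, n, h => action F (finCongr (Fin.sum_univ_succ n).symm)
      (disjUnion₂ F (h 0) (disjUnion fun i => h i.succ))

/-- The network operad `O_F = op(∫F)`, where the object `n` of `∫F` is named by `n ∈ ℕ`. -/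
def networkOperad : TypedOperadData.{0, u} ℕ :=
  (op (Groth F)).rename fun n => ⟨⟨n⟩⟩

theorem size_tensorTuple {k : ℕ} (n : Fin k → ℕ) :
    (tensorTuple fun i => (⟨⟨n i⟩⟩ : Groth F)).base.size = ∑ i, n i := by
  induction k with
  | zero => simp [tensorTuple]
  | succ k ih =>
    rw [Fin.sum_univ_succ, ← ih]
    rfl

/-- The operation in `O_F(n₁, …, nₖ; N)`, for `n₁ + ⋯ + nₖ = N`, that is given by a pair
`(σ, g)` of a permutation `σ ∈ S_N` and a network `g ∈ F(N)`: the morphism `(σ, g)` of `∫F`. -/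
def toOp {k : ℕ} {n : Fin k → ℕ} {N : ℕ} (h : ∑ i, n i = N) (x : Perm (Fin N) × F.obj ⟨N⟩) :
    (networkOperad F).Op n N :=
  (⟨⟨(finCongr ((size_tensorTuple F n).trans h)).trans x.1⟩, x.2⟩ :
    Groth.Hom (tensorTuple fun i => (⟨⟨n i⟩⟩ : Groth F)) ⟨⟨N⟩⟩)

end Network

theorem sum_flat {k : ℕ} {n : Fin k → ℕ} {N : ℕ} (h : ∑ i, n i = N) {j : Fin k → ℕ}
    {m : ∀ i, Fin (j i) → ℕ} (hm : ∀ i, ∑ q, m i q = n i) : ∑ p, flat m p = N := by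
  rw [← h, ← finSigmaFinEquiv.sum_comp, Fintype.sum_sigma]
  exact Finset.sum_congr rfl fun i _ => by simp only [flat_apply, hm]

end NetworkOperad

open NetworkOperad

namespace NetworkOperad
open Equiv

/-! A morphism of `Groth F` is a pair (bijection, network), and a bijection between finite sets
forces equal sizes. So the operations are pairs `(σ, g)` when the sizes add up, and there are none
otherwise (`bijective_toOp`, `sum_eq_of_op`).

The composition and action formulas hold because the canonical morphisms are invisible or explicit.
`flatHom` and `permHom` have trivial network component; `flatHom` preserves numerical positions
(`flatHom_val`) and `permHom` is the block permutation (`permHom_val`). What remains is the tensor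
product of morphisms, whose two components are the block sum of the bijections and the disjoint
union of the networks (`comp_toOp`, `act_toOp`).

The operad laws are then checked on pairs, without appeal to coherence. The permutation component
needs identities between block sums and block permutations (`blockSum_flat`, `blockPerm_mul`,
`blockSum_blockPerm`, `blockPerm_blockPerm`, `blockPerm_blockSum`). The network component needs the
corresponding facts about disjoint unions: they are multiplicative and natural (`disjUnion_mul`,
`action_blockSum`), associative (`disjUnion_flat`) and symmetric (`action_blockEquiv`). The last is
the network component of the naturality of `permHom`.

Since sizes such as that of a tensor product and a sum agree only propositionally, elements are
compared throughout by their values in ℕ. -/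

/-! ### Positions in sums and in sums of sums -/

theorem finSigmaFinEquiv_val_congr {k k' : ℕ} (hk : k = k') {n : Fin k → ℕ} {n' : Fin k' → ℕ}
    (h : ∀ i, n i = n' (Fin.cast hk i)) {i : Fin k} {i' : Fin k'} (hi : i.val = i'.val)
    {a : Fin (n i)} {a' : Fin (n' i')} (ha : a.val = a'.val) :
    (finSigmaFinEquiv ⟨i, a⟩ : ℕ) = finSigmaFinEquiv ⟨i', a'⟩ := by
  subst hk
  obtain rfl : n = n' := funext h
  obtain rfl := Fin.ext hi
  rw [Fin.ext ha]

theorem finSigmaFinEquiv_lt_iff {k : ℕ} {n : Fin k → ℕ} (x y : (i : Fin k) × Fin (n i)) :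
    finSigmaFinEquiv x < finSigmaFinEquiv y ↔
      x.1 < y.1 ∨ x.1 = y.1 ∧ x.2.val < y.2.val := by
  rw [Fin.lt_def]
  induction k with
  | zero => exact x.1.elim0
  | succ k ih =>
    obtain ⟨i, a⟩ := x
    obtain ⟨i', a'⟩ := y
    induction i using Fin.cases with
    | zero =>
      induction i' using Fin.cases with
      | zero => simp only [finSigmaFinEquiv_zero_val]; simp
      | succ i' =>
        rw [finSigmaFinEquiv_zero_val, finSigmaFinEquiv_succ_val]
        simp only [Fin.succ_pos, true_or, iff_true]
        omega
    | succ i =>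
      induction i' using Fin.cases with
      | zero =>
        rw [finSigmaFinEquiv_zero_val, finSigmaFinEquiv_succ_val]
        simp only [Fin.not_lt_zero, Fin.succ_ne_zero, false_and, or_false, iff_false]
        omega
      | succ i' =>
        rw [finSigmaFinEquiv_succ_val, finSigmaFinEquiv_succ_val, Nat.add_lt_add_iff_left,
          ih (n := fun i => n i.succ)]
        simp [Fin.succ_lt_succ_iff]

theorem lt_iff_finSigmaFinEquiv_symm {k : ℕ} {n : Fin k → ℕ} (x y : Fin (∑ i, n i)) :
    x < y ↔ (finSigmaFinEquiv.symm x).1 < (finSigmaFinEquiv.symm y).1 ∨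
      (finSigmaFinEquiv.symm x).1 = (finSigmaFinEquiv.symm y).1 ∧
        (finSigmaFinEquiv.symm x).2.val < (finSigmaFinEquiv.symm y).2.val := by
  rw [← finSigmaFinEquiv_lt_iff, apply_symm_apply, apply_symm_apply]

/-- A finite linear order has no order automorphism except the identity. This replaces computations
with partial sums: two numberings agree as soon as the passage between them is monotone. -/
theorem val_eq_of_strictMono {m n : ℕ} (h : m = n) {f : Fin m → Fin n} (hf : StrictMono f)
    (i : Fin m) : (f i).val = i.val := by
  subst h
  have hs : Function.Surjective f := Finite.surjective_of_injective hf.injective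
  exact Fin.coe_orderIso_apply (StrictMono.orderIsoOfSurjective f hf hs) i

theorem sum_flat_eq {k : ℕ} {j : Fin k → ℕ} (m : ∀ i, Fin (j i) → ℕ) :
    ∑ p, flat m p = ∑ i, ∑ q, m i q :=
  sum_flat rfl fun _ => rfl

/-- The position of the element `a` of the block `p` of a sum of sums. -/
def nestedPos {k : ℕ} {j : Fin k → ℕ} (m : ∀ i, Fin (j i) → ℕ) (p : (i : Fin k) × Fin (j i))
    (a : Fin (m p.1 p.2)) : Fin (∑ i, ∑ q, m i q) :=
  finSigmaFinEquiv (⟨p.1, finSigmaFinEquiv (⟨p.2, a⟩ : (q : Fin (j p.1)) × Fin (m p.1 q))⟩ :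
    (i : Fin k) × Fin (∑ q, m i q))

theorem nestedPos_lt {k : ℕ} {j : Fin k → ℕ} (m : ∀ i, Fin (j i) → ℕ)
    {p p' : (i : Fin k) × Fin (j i)} {a : Fin (m p.1 p.2)} {a' : Fin (m p'.1 p'.2)}
    (h : finSigmaFinEquiv p < finSigmaFinEquiv p' ∨ p = p' ∧ a.val < a'.val) :
    nestedPos m p a < nestedPos m p' a' := by
  obtain ⟨i, q⟩ := p
  obtain ⟨i', q'⟩ := p'
  rw [finSigmaFinEquiv_lt_iff] at h
  rw [nestedPos, nestedPos, finSigmaFinEquiv_lt_iff]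
  simp only at *
  rcases h with (h | ⟨rfl, h⟩) | ⟨h, h'⟩
  · exact Or.inl h
  · refine Or.inr ⟨rfl, ?_⟩
    rw [← Fin.lt_def, finSigmaFinEquiv_lt_iff]
    exact Or.inl h
  · cases h
    refine Or.inr ⟨rfl, ?_⟩
    rw [← Fin.lt_def, finSigmaFinEquiv_lt_iff]
    exact Or.inr ⟨rfl, h'⟩

/-- Both sides number the triples (outer block, inner block, offset) lexicographically, so the
passage `f` from one numbering to the other is strictly monotone and hence preserves values. -/
theorem finSigmaFinEquiv_flat_val {k : ℕ} {j : Fin k → ℕ} (m : ∀ i, Fin (j i) → ℕ)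
    (p : Fin (∑ i, j i)) (a : Fin (flat m p)) :
    (finSigmaFinEquiv ⟨p, a⟩ : ℕ) = nestedPos m (finSigmaFinEquiv.symm p) a := by
  let f : Fin (∑ p, flat m p) → Fin (∑ i, ∑ q, m i q) := fun x =>
    nestedPos m (finSigmaFinEquiv.symm (finSigmaFinEquiv.symm x).1) (finSigmaFinEquiv.symm x).2
  have hf : StrictMono f := by
    intro x y hxy
    rw [lt_iff_finSigmaFinEquiv_symm] at hxy
    apply nestedPos_lt
    rwa [apply_symm_apply, apply_symm_apply, finSigmaFinEquiv.symm.injective.eq_iff]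
  have := val_eq_of_strictMono (sum_flat_eq m) hf (finSigmaFinEquiv ⟨p, a⟩)
  simp only [f] at this
  rw [symm_apply_apply] at this
  exact this.symm

/-- The position of an element in a sum of sums. -/
theorem finSigmaFinEquiv_flat_val' {k : ℕ} {j : Fin k → ℕ} (m : ∀ i, Fin (j i) → ℕ)
    {p : Fin (∑ i, j i)} {i : Fin k} {q : Fin (j i)} (hp : p.val = finSigmaFinEquiv ⟨i, q⟩)
    (a : Fin (flat m p)) {a' : Fin (m i q)} (ha : a.val = a'.val) :
    (finSigmaFinEquiv ⟨p, a⟩ : ℕ) = finSigmaFinEquiv (⟨i, finSigmaFinEquiv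
      (⟨q, a'⟩ : (q : Fin (j i)) × Fin (m i q))⟩ : (i : Fin k) × Fin (∑ q, m i q)) := by
  rw [finSigmaFinEquiv_flat_val]
  -- The type of the offset depends on the pair `s`, so the equation of pairs can be substituted
  -- only after generalizing over both.
  have key : ∀ (s : (i : Fin k) × Fin (j i)) (b : Fin (m s.1 s.2)), s = ⟨i, q⟩ → b.val = a'.val →
      (nestedPos m s b).val = nestedPos m ⟨i, q⟩ a' := by
    rintro _ b rfl hb
    rw [Fin.ext hb]
  exact key _ _ ((symm_apply_eq _).2 (Fin.ext hp)) ha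

theorem flat_eq {T : Type*} {k : ℕ} {j : Fin k → ℕ} (b : ∀ i, Fin (j i) → T)
    {p : Fin (∑ i, j i)} {i : Fin k} {q : Fin (j i)} (hp : p.val = finSigmaFinEquiv ⟨i, q⟩) :
    flat b p = b i q := by
  obtain rfl := Fin.ext hp
  exact flat_apply b i q

/-! ### Block sums of permutations and block permutations -/

theorem blockSum_apply {k : ℕ} {n : Fin k → ℕ} (τ : ∀ i, Perm (Fin (n i))) (i : Fin k)
    (a : Fin (n i)) : blockSum τ (finSigmaFinEquiv ⟨i, a⟩) = finSigmaFinEquiv ⟨i, τ i a⟩ := by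
  induction k with
  | zero => exact i.elim0
  | succ k ih =>
    ext
    simp only [blockSum, permCongr_apply, finCongr_symm, finCongr_apply, Fin.val_cast]
    induction i using Fin.cases with
    | zero =>
      have : Fin.cast (Fin.sum_univ_succ n) (finSigmaFinEquiv ⟨0, a⟩) = Fin.castAdd _ a :=
        Fin.ext (finSigmaFinEquiv_zero_val a)
      rw [this, plus_castAdd, finSigmaFinEquiv_zero_val]
      rfl
    | succ i =>
      have : Fin.cast (Fin.sum_univ_succ n) (finSigmaFinEquiv ⟨i.succ, a⟩) =
          Fin.natAdd _ (finSigmaFinEquiv ⟨i, a⟩) :=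
        Fin.ext (finSigmaFinEquiv_succ_val i a)
      rw [this, plus_natAdd, finSigmaFinEquiv_succ_val, ih]
      rfl

/-- Knowing `x` only through its value absorbs the casts, so that such computations can be chained
even when the profiles differ. -/
theorem blockSum_val {k : ℕ} {n : Fin k → ℕ} {N : ℕ} (h : ∑ i, n i = N)
    (τ : ∀ i, Perm (Fin (n i))) {x : Fin N} {i : Fin k} {a : Fin (n i)}
    (hx : x.val = finSigmaFinEquiv ⟨i, a⟩) :
    ((finCongr h).permCongr (blockSum τ) x).val = finSigmaFinEquiv ⟨i, τ i a⟩ := by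
  subst h
  obtain rfl := Fin.ext hx
  exact congrArg Fin.val (blockSum_apply τ i a)

theorem blockPerm_val {k : ℕ} {n : Fin k → ℕ} {N : ℕ} (h : ∑ i, n i = N)
    (τ : Perm (Fin k)) {x : Fin N} {i : Fin k} {a : Fin (n (τ i))}
    (hx : x.val = finSigmaFinEquiv (⟨i, a⟩ : (i : Fin k) × Fin (n (τ i)))) :
    (blockPerm h τ x).val = finSigmaFinEquiv ⟨τ i, a⟩ := by
  have : (finCongr (sum_perm h τ)).symm x =
    finSigmaFinEquiv (⟨i, a⟩ : (i : Fin k) × Fin (n (τ i))) := Fin.ext hx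
  simp only [blockPerm, trans_apply, this, blockEquiv, symm_apply_apply]
  rfl

theorem exists_block {k : ℕ} {n : Fin k → ℕ} {N : ℕ} (h : ∑ i, n i = N) (x : Fin N) :
    ∃ (i : Fin k) (a : Fin (n i)), x.val = finSigmaFinEquiv ⟨i, a⟩ := by
  subst h
  obtain ⟨⟨i, a⟩, rfl⟩ := finSigmaFinEquiv.surjective x
  exact ⟨i, a, rfl⟩

theorem blockSum_one {k : ℕ} (n : Fin k → ℕ) :
    blockSum (fun i => (1 : Perm (Fin (n i)))) = 1 := by
  ext x
  obtain ⟨⟨i, a⟩, rfl⟩ := finSigmaFinEquiv.surjective x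
  rw [blockSum_apply]
  rfl

theorem blockSum_mul {k : ℕ} {n : Fin k → ℕ} (σ τ : ∀ i, Perm (Fin (n i))) :
    blockSum (fun i => σ i * τ i) = blockSum σ * blockSum τ := by
  ext x
  obtain ⟨⟨i, a⟩, rfl⟩ := finSigmaFinEquiv.surjective x
  rw [Perm.mul_apply, blockSum_apply, blockSum_apply, blockSum_apply]
  rfl

theorem blockSum_nestedPos {k : ℕ} {j : Fin k → ℕ} {m : ∀ i, Fin (j i) → ℕ}
    (τ : ∀ i q, Perm (Fin (m i q))) (p : (i : Fin k) × Fin (j i)) (a : Fin (m p.1 p.2)) :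
    blockSum (fun i => blockSum (τ i)) (nestedPos m p a) = nestedPos m p (τ p.1 p.2 a) := by
  rw [nestedPos, nestedPos, blockSum_apply, blockSum_apply]

/-- The permutation component of associativity: either way an element keeps its outer and inner
block, and only its offset moves. -/
theorem blockSum_flat {k : ℕ} {j : Fin k → ℕ} {m : ∀ i, Fin (j i) → ℕ}
    (τ : ∀ i q, Perm (Fin (m i q))) :
    (finCongr (sum_flat_eq m)).permCongr (blockSum (n := flat m)
      fun p => τ (finSigmaFinEquiv.symm p).1 (finSigmaFinEquiv.symm p).2) =
      blockSum fun i => blockSum (τ i) := by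
  ext x
  obtain ⟨p, a, hx⟩ := exists_block (sum_flat_eq m) x
  refine (blockSum_val (sum_flat_eq m) (n := flat m) (fun p => τ _ _) hx).trans ?_
  rw [finSigmaFinEquiv_flat_val] at hx ⊢
  obtain rfl := Fin.ext hx
  exact (congrArg Fin.val (blockSum_nestedPos τ _ _)).symm

theorem blockPerm_one {k : ℕ} {n : Fin k → ℕ} {N : ℕ} (h : ∑ i, n i = N) :
    blockPerm h 1 = 1 := by
  ext x
  obtain ⟨i, a, hx⟩ := exists_block h x
  exact (blockPerm_val h 1 (i := i) (a := a) hx).trans hx.symm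

/-- The factor for `τ` is taken over the profile already permuted by `σ`; this is what makes the
action a right action. -/
theorem blockPerm_mul {k : ℕ} {n : Fin k → ℕ} {N : ℕ} (h : ∑ i, n i = N) (σ τ : Perm (Fin k)) :
    blockPerm h (σ * τ) = blockPerm h σ * blockPerm (sum_perm h σ) τ := by
  ext x
  obtain ⟨i, a, hx⟩ := exists_block (sum_perm (sum_perm h σ) τ) x
  exact (blockPerm_val h (σ * τ) (i := i) (a := a) hx).trans
    (blockPerm_val h σ (blockPerm_val (sum_perm h σ) τ hx)).symm

/-- Acting inside the blocks before or after moving them is the same, provided `ρ` is reindexed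
along `τ`. It serves equivariance in the outer operation. -/
theorem blockSum_blockPerm {k : ℕ} {n : Fin k → ℕ} {N : ℕ} (h : ∑ i, n i = N)
    (ρ : ∀ i, Perm (Fin (n i))) (τ : Perm (Fin k)) :
    blockPerm h τ * (finCongr (sum_perm h τ)).permCongr (blockSum fun i => ρ (τ i)) =
      (finCongr h).permCongr (blockSum ρ) * blockPerm h τ := by
  ext x
  obtain ⟨i, a, hx⟩ := exists_block (sum_perm h τ) x
  rw [Perm.mul_apply, Perm.mul_apply, blockPerm_val h τ (blockSum_val _ _ hx),
    blockSum_val h ρ (blockPerm_val h τ hx)]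

theorem exists_block_flat {k : ℕ} {j : Fin k → ℕ} {m : ∀ i, Fin (j i) → ℕ} {n : Fin k → ℕ}
    {N : ℕ} (h : ∑ i, n i = N) (hm : ∀ i, ∑ q, m i q = n i) (x : Fin N) :
    ∃ (i : Fin k) (q : Fin (j i)) (a : Fin (m i q)), x.val = finSigmaFinEquiv (⟨i, Fin.cast (hm i)
      (finSigmaFinEquiv (⟨q, a⟩ : (q : Fin (j i)) × Fin (m i q)))⟩ : (i : Fin k) × Fin (n i)) := by
  obtain rfl : _ = n := funext hm
  obtain ⟨i, a, hx⟩ := exists_block h x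
  obtain ⟨⟨q, a⟩, rfl⟩ := finSigmaFinEquiv.surjective a
  exact ⟨i, q, a, hx⟩

theorem flat_blockPerm {T : Type*} {k : ℕ} {j : Fin k → ℕ} (b : ∀ i, Fin (j i) → T)
    (τ : Perm (Fin k)) (p : Fin (∑ i, j i)) :
    flat b (blockPerm rfl τ p) = flat (fun i => b (τ i)) (Fin.cast (sum_perm rfl τ).symm p) := by
  obtain ⟨i, q, hp⟩ := exists_block (sum_perm rfl τ) p
  rw [flat_eq b (blockPerm_val rfl τ hp), flat_eq (fun i => b (τ i)) (i := i) (q := q) hp]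

theorem flat_blockSum {T : Type*} {k : ℕ} {j : Fin k → ℕ} (b : ∀ i, Fin (j i) → T)
    (τ : ∀ i, Perm (Fin (j i))) (p : Fin (∑ i, j i)) :
    flat b (blockSum τ p) = flat (fun i q => b i (τ i q)) p := by
  obtain ⟨⟨i, q⟩, rfl⟩ := finSigmaFinEquiv.surjective p
  rw [blockSum_apply, flat_apply, flat_apply]

/-- Moving outer blocks whole also moves their inner blocks whole. Both sides send the element at
offset `a` of the inner block `q` of the outer block `i` to the same offset and inner block of the
outer block `τ i`. -/
theorem blockPerm_blockPerm {k : ℕ} {j : Fin k → ℕ} {m : ∀ i, Fin (j i) → ℕ} {n : Fin k → ℕ}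
    {N : ℕ} (h : ∑ i, n i = N) (hm : ∀ i, ∑ q, m i q = n i) (τ : Perm (Fin k)) :
    blockPerm (sum_flat h hm) (blockPerm rfl τ) = blockPerm h τ := by
  obtain rfl : _ = n := funext hm
  ext x
  obtain ⟨i, q, a, hx⟩ := exists_block_flat (m := fun i => m (τ i)) (sum_perm h τ)
    (fun i => hm (τ i)) x
  let p : Fin (∑ i, j i) := Fin.cast (sum_perm rfl τ) (finSigmaFinEquiv
    (⟨i, q⟩ : (i : Fin k) × Fin (j (τ i))))
  have hp : (blockPerm rfl τ p).val = finSigmaFinEquiv ⟨τ i, q⟩ := blockPerm_val rfl τ rfl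
  have hf : m (τ i) q = flat m (blockPerm rfl τ p) := (flat_eq m hp).symm
  rw [blockPerm_val h τ hx]
  -- The left side reads `x` in the flattened profile permuted by `blockPerm rfl τ`, where its inner
  -- block has index `p`. The nested position is flattened first, then matched with that profile.
  have hx' : x.val = finSigmaFinEquiv
      (⟨p, Fin.cast hf a⟩ : (p : Fin (∑ i, j i)) × Fin (flat m (blockPerm rfl τ p))) := by
    rw [hx]
    refine Eq.trans ?_ (finSigmaFinEquiv_val_congr (sum_perm rfl τ)
      (n := flat fun i => m (τ i)) (n' := fun p => flat m (blockPerm rfl τ p))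
      (fun i => (flat_blockPerm m τ (Fin.cast _ i)).symm)
      (i := finSigmaFinEquiv ⟨i, q⟩) (a := Fin.cast (flat_apply _ _ _).symm a) rfl rfl)
    exact (finSigmaFinEquiv_flat_val' _ rfl _ rfl).symm
  rw [blockPerm_val (sum_flat h hm) (blockPerm rfl τ) hx']
  exact finSigmaFinEquiv_flat_val' _ hp _ rfl

/-- Permuting inner blocks without leaving their outer blocks is a block sum of block permutations.
It serves equivariance in the inner operations. -/
theorem blockPerm_blockSum {k : ℕ} {j : Fin k → ℕ} {m : ∀ i, Fin (j i) → ℕ} {n : Fin k → ℕ}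
    {N : ℕ} (h : ∑ i, n i = N) (hm : ∀ i, ∑ q, m i q = n i) (τ : ∀ i, Perm (Fin (j i))) :
    blockPerm (sum_flat h hm) (blockSum τ) =
      (finCongr h).permCongr (blockSum fun i => blockPerm (hm i) (τ i)) := by
  obtain rfl : _ = n := funext hm
  ext x
  obtain ⟨i, q, a, hx⟩ := exists_block_flat (m := fun i q => m i (τ i q)) h
    (fun i => sum_perm (hm i) (τ i)) x
  rw [blockSum_val h _ hx]
  have hp : (blockSum τ (finSigmaFinEquiv ⟨i, q⟩)).val = finSigmaFinEquiv ⟨i, τ i q⟩ :=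
    congrArg Fin.val (blockSum_apply τ i q)
  have hf : m i (τ i q) = flat m (blockSum τ (finSigmaFinEquiv ⟨i, q⟩)) := (flat_eq m hp).symm
  have hx' : x.val = finSigmaFinEquiv (⟨finSigmaFinEquiv ⟨i, q⟩, Fin.cast hf a⟩ :
      (p : Fin (∑ i, j i)) × Fin (flat m (blockSum τ p))) := by
    rw [hx]
    refine Eq.trans ?_ (finSigmaFinEquiv_val_congr rfl
      (n := flat fun i q => m i (τ i q)) (n' := fun p => flat m (blockSum τ p))
      (fun i => (flat_blockSum m τ _).symm)
      (i := finSigmaFinEquiv ⟨i, q⟩) (a := Fin.cast (flat_apply _ _ _).symm a) rfl rfl)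
    refine Eq.trans ?_ (finSigmaFinEquiv_flat_val' (fun i q => m i (τ i q)) rfl _
      (a' := a) rfl).symm
    exact finSigmaFinEquiv_val_congr rfl (fun i => (sum_perm (hm i) (τ i)).symm) rfl rfl
  rw [blockPerm_val (sum_flat h hm) (blockSum τ) hx']
  refine (finSigmaFinEquiv_flat_val' _ hp _ (a' := a) rfl).trans ?_
  refine finSigmaFinEquiv_val_congr rfl (fun i => hm i) rfl ?_
  exact (blockPerm_val (hm i) (τ i) rfl).symm

/-! ### Naturality of the permutation of tensor factors -/

section Naturality

variable {C : Type v} [Category.{w} C] [MonoidalCategory C]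

theorem tensorTupleMap_reindex {K k : ℕ} {c d : Fin K → C} (f : ∀ i, c i ⟶ d i)
    {e e' : Fin k → Fin K} (h : e = e')
    (hc : tensorTuple (fun i => c (e i)) = tensorTuple (fun i => c (e' i)))
    (hd : tensorTuple (fun i => d (e i)) = tensorTuple (fun i => d (e' i))) :
    tensorTupleMap (fun i => f (e i)) ≫ eqToHom hd =
      eqToHom hc ≫ tensorTupleMap (fun i => f (e' i)) := by
  subst h
  simp

/-- One recursion step of `permHom`: the squares for the reindexing, the recursive call and the
insertion paste together. -/
theorem tensor_square {X X' U U' V V' W W' T T' : C} {x : X ⟶ X'} {u : U ⟶ U'} {v : V ⟶ V'}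
    {w : W ⟶ W'} {t : T ⟶ T'} {e : U ⟶ V} {e' : U' ⟶ V'} {p : V ⟶ W} {p' : V' ⟶ W'}
    {s : X ⊗ W ⟶ T} {s' : X' ⊗ W' ⟶ T'} (hu : u ≫ e' = e ≫ v) (hv : v ≫ p' = p ≫ w)
    (hs : (x ⊗ₘ w) ≫ s' = s ≫ t) :
    (x ⊗ₘ u) ≫ (X' ◁ (e' ≫ p')) ≫ s' = ((X ◁ (e ≫ p)) ≫ s) ≫ t := by
  rw [Category.assoc, ← hs, ← id_tensorHom, ← id_tensorHom, tensorHom_comp_tensorHom_assoc,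
    tensorHom_comp_tensorHom_assoc, Category.comp_id, Category.id_comp, reassoc_of% hu, hv,
    Category.assoc]

variable [BraidedCategory C]

/-- One recursion step of `insertHom`: besides the two given squares, only naturality of the
associator and of the braiding enters. -/
theorem braiding_square {X X' Y Y' U U' V V' T T' : C} {x : X ⟶ X'} {y : Y ⟶ Y'} {u : U ⟶ U'}
    {v : V ⟶ V'} {t : T ⟶ T'} {e : U ⟶ V} {e' : U' ⟶ V'} {s : X ⊗ V ⟶ T} {s' : X' ⊗ V' ⟶ T'}
    (hu : u ≫ e' = e ≫ v) (hs : (x ⊗ₘ v) ≫ s' = s ≫ t) :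
    (x ⊗ₘ (y ⊗ₘ u)) ≫ (α_ _ _ _).inv ≫ ((β_ X' Y').hom ▷ _) ≫ (α_ _ _ _).hom ≫
        (Y' ◁ (X' ◁ e' ≫ s')) =
      ((α_ _ _ _).inv ≫ ((β_ X Y).hom ▷ _) ≫ (α_ _ _ _).hom ≫ (Y ◁ (X ◁ e ≫ s))) ≫
        (y ⊗ₘ t) := by
  simp only [Category.assoc]
  rw [associator_inv_naturality_assoc, ← tensorHom_id, tensorHom_comp_tensorHom_assoc,
    BraidedCategory.braiding_naturality, Category.comp_id,
    ← Category.id_comp u, ← tensorHom_comp_tensorHom_assoc, tensorHom_id,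
    associator_naturality_assoc]
  simp only [← id_tensorHom, tensorHom_comp_tensorHom, tensorHom_comp_tensorHom_assoc,
    Category.comp_id, Category.id_comp, Category.assoc, ← hs, hu]

theorem insertHom_natural : {k : ℕ} → {c d : Fin (k + 1) → C} → (f : ∀ i, c i ⟶ d i) →
    (p : Fin (k + 1)) →
    (f p ⊗ₘ tensorTupleMap fun i => f (p.succAbove i)) ≫ insertHom d p =
      insertHom c p ≫ tensorTupleMap f
  | 0, c, d, f, p => by
      obtain rfl := Fin.eq_zero p
      exact (Category.comp_id _).trans (Category.id_comp _).symm
  | k + 1, c, d, f, p => by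
      induction p using Fin.cases with
      | zero => exact (Category.comp_id _).trans (Category.id_comp _).symm
      | succ q =>
        exact braiding_square
          (tensorTupleMap_reindex f
            (e := fun i : Fin k => q.succ.succAbove i.succ) (e' := fun i => (q.succAbove i).succ)
            (by simp) (by simp) (by simp))
          (insertHom_natural (fun i => f i.succ) q)

theorem permHom_natural : {k : ℕ} → {c d : Fin k → C} → (f : ∀ i, c i ⟶ d i) →
    (τ : Perm (Fin k)) →
    tensorTupleMap (fun i => f (τ i)) ≫ permHom d τ = permHom c τ ≫ tensorTupleMap f
  | 0, _, _, _, _ => rfl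
  | k + 1, c, d, f, τ =>
      tensor_square
        (tensorTupleMap_reindex f
          (e := fun i : Fin k => τ i.succ) (e' := fun i => (τ 0).succAbove (permTail τ i))
          (by simp only [succAbove_permTail]) (by simp only [succAbove_permTail])
          (by simp only [succAbove_permTail]))
        (permHom_natural (fun i => f ((τ 0).succAbove i)) (permTail τ))
        (insertHom_natural f (τ 0))

end Naturality

/-! ### Canonical morphisms in the Grothendieck construction -/

noncomputable section Canonical

variable {F : SymGpd ⥤ MonCat.{u}}

theorem eqToHom_val {X Y : Groth F} (h : X = Y) (i : Fin X.base.size) :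
    ((eqToHom h).base.toEquiv i).val = i.val := by
  subst h
  rfl

theorem eqToHom_elem {X Y : Groth F} (h : X = Y) : (eqToHom h).elem = 1 := by
  subst h
  rfl

theorem comp_elem_one {X Y Z : Groth F} {f : X ⟶ Y} {g : Y ⟶ Z} (hf : f.elem = 1)
    (hg : g.elem = 1) : (f ≫ g).elem = 1 := by
  rw [Groth.comp_elem, hf, hg, map_one, one_mul]

variable [F.LaxBraided]

theorem whiskerLeft_elem_one (X : Groth F) {Y Z : Groth F} {f : Y ⟶ Z} (hf : f.elem = 1) :
    (X ◁ f).elem = 1 := by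
  rw [Groth.whiskerLeft_elem, hf]
  exact lax_one

theorem whiskerRight_elem_one (X : Groth F) {Y Z : Groth F} {f : Y ⟶ Z} (hf : f.elem = 1) :
    (f ▷ X).elem = 1 := by
  rw [Groth.whiskerRight_elem, hf]
  exact lax_one

theorem whiskerLeft_val (X : Groth F) {Y Z : Groth F} {f : Y ⟶ Z}
    (hf : ∀ i, (f.base.toEquiv i).val = i.val) (i : Fin (X ⊗ Y).base.size) :
    ((X ◁ f).base.toEquiv i).val = i.val := by
  refine Fin.addCases (fun a => ?_) (fun a => ?_) i
  · exact congrArg Fin.val (plus_castAdd _ _ a)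
  · refine (congrArg Fin.val (plus_natAdd _ _ a)).trans ?_
    exact congrArg (X.base.size + ·) (hf a)

/-- Associators, unitors, braidings and `eqToHom` all carry the unit network, and composition and
whiskering preserve this. The same argument covers the other canonical morphisms. -/
theorem appendHom_elem : {m n : ℕ} → (u : Fin m → Groth F) → (v : Fin n → Groth F) →
    (appendHom u v).elem = 1
  | 0, _, _, _ => comp_elem_one (eqToHom_elem _) rfl
  | _ + 1, _, _, _ => comp_elem_one (eqToHom_elem _)
      (comp_elem_one (whiskerLeft_elem_one _ (appendHom_elem _ _)) rfl)

theorem flatHom_elem : {k : ℕ} → {j : Fin k → ℕ} → (b : ∀ i, Fin (j i) → Groth F) →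
    (flatHom b).elem = 1
  | 0, _, _ => eqToHom_elem _
  | _ + 1, _, _ => comp_elem_one (eqToHom_elem _)
      (comp_elem_one (appendHom_elem _ _) (whiskerLeft_elem_one _ (flatHom_elem _)))

theorem insertHom_elem : {k : ℕ} → (c : Fin (k + 1) → Groth F) → (p : Fin (k + 1)) →
    (insertHom c p).elem = 1
  | 0, c, p => eqToHom_elem _
  | k + 1, c, p => by
      induction p using Fin.cases with
      | zero => rfl
      | succ q =>
        exact comp_elem_one rfl (comp_elem_one (whiskerRight_elem_one _ rfl) (comp_elem_one rfl
          (whiskerLeft_elem_one _ (comp_elem_one (whiskerLeft_elem_one _ (eqToHom_elem _))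
            (insertHom_elem _ q)))))

theorem permHom_elem : {k : ℕ} → (c : Fin k → Groth F) → (τ : Perm (Fin k)) →
    (permHom c τ).elem = 1
  | 0, _, _ => rfl
  | _ + 1, _, _ => comp_elem_one
      (whiskerLeft_elem_one _ (comp_elem_one (eqToHom_elem _) (permHom_elem _ _)))
      (insertHom_elem _ _)

theorem appendHom_val : {m n : ℕ} → (u : Fin m → Groth F) → (v : Fin n → Groth F) →
    (i : _) → ((appendHom u v).base.toEquiv i).val = i.val
  | 0, n, u, v, i => (eqToHom_val (tensorTuple_congr (Nat.zero_add n) (fun i => by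
        rw [Fin.append_left_nil u v rfl]; rfl)) i)
  | m + 1, n, u, v, i => (whiskerLeft_val _ (appendHom_val _ _) _).trans
      (eqToHom_val (tensorTuple_congr (Nat.add_right_comm m 1 n) (append_succ u v)) i)

theorem flatHom_val : {k : ℕ} → {j : Fin k → ℕ} → (b : ∀ i, Fin (j i) → Groth F) → (i : _) →
    ((flatHom b).base.toEquiv i).val = i.val
  | 0, _, _, i => eqToHom_val (tensorTuple_congr (k' := 0) (c' := Fin.elim0) (by simp)
      (fun i => (Fin.cast (by simp) i : Fin 0).elim0)) i
  | _ + 1, j, b, i => (whiskerLeft_val _ (flatHom_val _) _).trans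
      ((appendHom_val _ _ _).trans
        (eqToHom_val (tensorTuple_congr (Fin.sum_univ_succ j) (flat_succ b)) i))

/-- The `a`-th element of the `i`-th block of a tensor product. -/
def tensorPos : {k : ℕ} → (c : Fin k → Groth F) → (i : Fin k) → Fin (c i).base.size →
    Fin (tensorTuple c).base.size
  | _ + 1, c, i, a => Fin.cases
      (motive := fun i => Fin (c i).base.size → Fin (tensorTuple c).base.size)
      (fun a => Fin.castAdd (tensorTuple fun i => c i.succ).base.size a)
      (fun i a => Fin.natAdd (c 0).base.size (tensorPos (fun i => c i.succ) i a)) i a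

theorem tensorPos_val {k : ℕ} (c : Fin k → Groth F) (i : Fin k) (a : Fin (c i).base.size) :
    (tensorPos c i a).val =
      finSigmaFinEquiv (⟨i, a⟩ : (i : Fin k) × Fin (c i).base.size) := by
  induction k with
  | zero => exact i.elim0
  | succ k ih =>
    induction i using Fin.cases with
    | zero => exact (finSigmaFinEquiv_zero_val (j := fun i => (c i).base.size) a).symm
    | succ i =>
      refine Eq.trans ?_ (finSigmaFinEquiv_succ_val (j := fun i => (c i).base.size) i a).symm
      exact congrArg ((c 0).base.size + ·) (ih (fun i => c i.succ) i a)

theorem tensorPos_congr {k : ℕ} {c c' : Fin k → Groth F} (h : ∀ i, c i = c' i) {i i' : Fin k}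
    (hi : i = i') {a : Fin (c i).base.size} {a' : Fin (c' i').base.size} (ha : a.val = a'.val) :
    (tensorPos c i a).val = (tensorPos c' i' a').val := by
  obtain rfl : c = c' := funext h
  subst hi
  rw [Fin.ext ha]

theorem exists_tensorPos {k : ℕ} (c : Fin k → Groth F) (x : Fin (tensorTuple c).base.size) :
    ∃ i a, x = tensorPos c i a := by
  -- By eta for structures, `c i` is the object named by its own size, so the size formula applies
  -- to any tuple.
  obtain ⟨i, a, h⟩ := exists_block (size_tensorTuple F (fun i => (c i).base.size)).symm x
  exact ⟨i, a, Fin.ext (h.trans (tensorPos_val c i a).symm)⟩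

theorem tensorTupleMap_tensorPos {k : ℕ} {c d : Fin k → Groth F} (f : ∀ i, c i ⟶ d i) (i : Fin k)
    (a : Fin (c i).base.size) : (tensorTupleMap f).base.toEquiv (tensorPos c i a) =
      tensorPos d i ((f i).base.toEquiv a) := by
  induction k with
  | zero => exact i.elim0
  | succ k ih =>
    induction i using Fin.cases with
    | zero => exact plus_castAdd _ _ a
    | succ i =>
      refine (plus_natAdd _ _ _).trans ?_
      exact congrArg (Fin.natAdd (d 0).base.size) (ih (fun i => f i.succ) i a)

end Canonical

/-! ### Operations, composition and action in terms of pairs -/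

noncomputable section Formulas

variable {F : SymGpd ⥤ MonCat.{u}}

/-- The bijection underlying one step of `insertHom`. -/
def swapStep {l m n n' t : ℕ} (e : Fin n ≃ Fin n') (s : Fin (l + n') ≃ Fin t) :
    Fin (l + (m + n)) ≃ Fin (m + t) :=
  (finCongr (Nat.add_assoc l m n).symm).trans ((plus finAddFlip (Equiv.refl _)).trans
    ((finCongr (Nat.add_assoc m l n)).trans
      (plus (Equiv.refl _) ((plus (Equiv.refl _) e).trans s))))

/-- An insertion step involves three kinds of elements: those of the inserted factor, treated here,
those of the front factor it passes, and those of the remaining factors. -/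
theorem swapStep_castAdd {l m n n' t : ℕ} (e : Fin n ≃ Fin n') (s : Fin (l + n') ≃ Fin t)
    (a : Fin l) : swapStep (m := m) e s (Fin.castAdd _ a) = Fin.natAdd m (s (Fin.castAdd _ a)) := by
  have h₁ : finCongr (Nat.add_assoc l m n).symm (Fin.castAdd (m + n) a) =
    Fin.castAdd n (Fin.castAdd m a) := rfl
  have h₂ : finCongr (Nat.add_assoc m l n) (Fin.castAdd n (Fin.natAdd m a)) =
    Fin.natAdd m (Fin.castAdd n a) := rfl
  simp only [swapStep, trans_apply, h₁, plus_castAdd, finAddFlip_apply_castAdd, h₂, plus_natAdd,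
    refl_apply]

theorem swapStep_natAdd_castAdd {l m n n' t : ℕ} (e : Fin n ≃ Fin n') (s : Fin (l + n') ≃ Fin t)
    (a : Fin m) : swapStep e s (Fin.natAdd l (Fin.castAdd n a)) = Fin.castAdd _ a := by
  have h₁ : finCongr (Nat.add_assoc l m n).symm (Fin.natAdd l (Fin.castAdd n a)) =
    Fin.castAdd n (Fin.natAdd l a) := rfl
  have h₂ : finCongr (Nat.add_assoc m l n) (Fin.castAdd n (Fin.castAdd l a)) =
    Fin.castAdd (l + n) a := rfl
  simp only [swapStep, trans_apply, h₁, plus_castAdd, finAddFlip_apply_natAdd, h₂, refl_apply]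

theorem swapStep_natAdd_natAdd {l m n n' t : ℕ} (e : Fin n ≃ Fin n') (s : Fin (l + n') ≃ Fin t)
    (a : Fin n) : swapStep e s (Fin.natAdd l (Fin.natAdd m a)) =
      Fin.natAdd m (s (Fin.natAdd l (e a))) := by
  have h₁ : finCongr (Nat.add_assoc l m n).symm (Fin.natAdd l (Fin.natAdd m a)) =
    Fin.natAdd (l + m) a := Fin.ext (by simp; omega)
  have h₂ : finCongr (Nat.add_assoc m l n) (Fin.natAdd (m + l) a) =
    Fin.natAdd m (Fin.natAdd l a) := Fin.ext (by simp; omega)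
  simp only [swapStep, trans_apply, h₁, plus_natAdd, h₂, refl_apply]

theorem action_action {l m n : ℕ} (σ : Fin l ≃ Fin m) (τ : Fin m ≃ Fin n) (g : F.obj ⟨l⟩) :
    action F τ (action F σ g) = action F (σ.trans τ) g :=
  (ConcreteCategory.congr_hom (F.map_comp (SymGpd.ofEquiv σ) (SymGpd.ofEquiv τ)) g).symm

theorem action_refl {n : ℕ} (g : F.obj ⟨n⟩) : action F (Equiv.refl _) g = g :=
  ConcreteCategory.congr_hom (F.map_id ⟨n⟩) g

theorem action_mul {m n : ℕ} (σ : Fin m ≃ Fin n) (g h : F.obj ⟨m⟩) :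
    action F σ (g * h) = action F σ g * action F σ h := map_mul (F.map _).hom g h

theorem action_one {m n : ℕ} (σ : Fin m ≃ Fin n) : action F σ 1 = 1 := map_one (F.map _).hom

variable [F.LaxBraided]

theorem insertHom_castAdd : {k : ℕ} → (c : Fin (k + 1) → Groth F) → (p : Fin (k + 1)) →
    (a : Fin (c p).base.size) →
    (insertHom c p).base.toEquiv (Fin.castAdd _ a) = tensorPos c p a
  | 0, c, p, a => by
      obtain rfl := Fin.eq_zero p
      exact Fin.ext (eqToHom_val _ _)
  | k + 1, c, p, a => by
      induction p using Fin.cases with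
      | zero => rfl
      | succ q =>
        refine (swapStep_castAdd _ _ a).trans ?_
        exact congrArg (Fin.natAdd (c 0).base.size) (insertHom_castAdd (fun i => c i.succ) q a)

theorem insertHom_natAdd : {k : ℕ} → (c : Fin (k + 1) → Groth F) → (p : Fin (k + 1)) →
    (i : Fin k) → (a : Fin (c (p.succAbove i)).base.size) →
    (insertHom c p).base.toEquiv (Fin.natAdd _ (tensorPos (fun i => c (p.succAbove i)) i a)) =
      tensorPos c (p.succAbove i) a
  | 0, _, _, i, _ => i.elim0
  | k + 1, c, p, i, a => by
      induction p using Fin.cases with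
      | zero => rfl
      | succ q =>
        induction i using Fin.cases with
        | zero => exact swapStep_natAdd_castAdd _ _ a
        | succ i =>
          refine (swapStep_natAdd_natAdd _ _ _).trans ?_
          -- The two index expressions agree only propositionally, so `a` is transported along the
          -- equality of sizes and values are compared.
          have hc : c (q.succ.succAbove i.succ) = c (q.succAbove i).succ := by simp
          have hs : (c (q.succ.succAbove i.succ)).base.size = (c (q.succAbove i).succ).base.size := by
            rw [hc]
          refine Eq.trans ?_ ((congrArg (Fin.natAdd (c 0).base.size) (insertHom_natAdd
            (fun i => c i.succ) q i (Fin.cast hs a))).trans (Fin.ext ?_))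
          · refine congrArg (fun x => Fin.natAdd (c 0).base.size ((insertHom
              (fun i => c i.succ) q).base.toEquiv (Fin.natAdd (c q.succ).base.size x)))
              (Fin.ext ((eqToHom_val _ _).trans ?_))
            exact tensorPos_congr (fun i => by simp) rfl rfl
          · exact tensorPos_congr (c := c) (i := (q.succAbove i).succ) (fun _ => rfl) (by simp) rfl

/-- By recursion: the first factor is inserted at position `τ 0`, and the others are placed by
`permTail τ` in the complement of that position. -/
theorem permHom_tensorPos : {k : ℕ} → (c : Fin k → Groth F) → (τ : Perm (Fin k)) → (i : Fin k) →
    (a : Fin (c (τ i)).base.size) →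
    (permHom c τ).base.toEquiv (tensorPos (fun i => c (τ i)) i a) = tensorPos c (τ i) a
  | 0, _, _, i, _ => i.elim0
  | k + 1, c, τ, i, a => by
      induction i using Fin.cases with
      | zero =>
        refine Eq.trans ?_ (insertHom_castAdd c (τ 0) a)
        exact congrArg (insertHom c (τ 0)).base.toEquiv (plus_castAdd _ _ a)
      | succ i =>
        have hc : c (τ i.succ) = c ((τ 0).succAbove (permTail τ i)) := by
          rw [succAbove_permTail]
        have hs : (c (τ i.succ)).base.size =
          (c ((τ 0).succAbove (permTail τ i))).base.size := by rw [hc]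
        refine Eq.trans ?_ ((insertHom_natAdd c (τ 0) (permTail τ i) (Fin.cast hs a)).trans
          (Fin.ext ?_))
        · refine congrArg (insertHom c (τ 0)).base.toEquiv ((plus_natAdd _ _ _).trans ?_)
          refine congrArg (Fin.natAdd (c (τ 0)).base.size) ?_
          refine Eq.trans ?_ (permHom_tensorPos (fun i => c ((τ 0).succAbove i)) (permTail τ) i
            (Fin.cast hs a))
          refine congrArg (permHom (fun i => c ((τ 0).succAbove i)) (permTail τ)).base.toEquiv
            (Fin.ext ((eqToHom_val _ _).trans ?_))
          exact tensorPos_congr (fun i => by rw [succAbove_permTail]) rfl rfl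
        · exact tensorPos_congr (c := c) (fun _ => rfl) (succAbove_permTail τ i) rfl

theorem permHom_val {k : ℕ} (n : Fin k → ℕ) (τ : Perm (Fin k))
    (x : Fin (tensorTuple fun i => (⟨⟨n (τ i)⟩⟩ : Groth F)).base.size) :
    ((permHom (fun i => (⟨⟨n i⟩⟩ : Groth F)) τ).base.toEquiv x).val =
      blockEquiv n τ (Fin.cast (size_tensorTuple F _) x) := by
  obtain ⟨i, a, rfl⟩ := exists_tensorPos _ x
  refine (congrArg Fin.val (permHom_tensorPos (fun i => (⟨⟨n i⟩⟩ : Groth F)) τ i a)).trans ?_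
  rw [tensorPos_val]
  have : Fin.cast (size_tensorTuple F fun i => n (τ i))
      (tensorPos (fun i => (⟨⟨n (τ i)⟩⟩ : Groth F)) i a) =
    finSigmaFinEquiv (⟨i, a⟩ : (i : Fin k) × Fin (n (τ i))) := 
      Fin.ext (tensorPos_val (fun i => (⟨⟨n (τ i)⟩⟩ : Groth F)) i a)
  rw [this, blockEquiv, trans_apply, symm_apply_apply]
  rfl

theorem action_disjUnion₂ {m m' n n' : ℕ} (σ : Fin m ≃ Fin m') (τ : Fin n ≃ Fin n')
    (g : F.obj ⟨m⟩) (h : F.obj ⟨n⟩) : action F (plus σ τ) (disjUnion₂ F g h) =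
      disjUnion₂ F (action F σ g) (action F τ h) :=
  lax_natural (SymGpd.ofEquiv σ) (SymGpd.ofEquiv τ) g h

theorem plus_refl_finCongr {l m n : ℕ} (h : m = n) :
    plus (Equiv.refl (Fin l)) (finCongr h) = finCongr (congrArg (l + ·) h) := by
  subst h
  ext i
  refine Fin.addCases (fun a => ?_) (fun a => ?_) i
  · rw [plus_castAdd]; rfl
  · rw [plus_natAdd]; rfl

/-- Both sides iterate the same lax structure map; only the names of the total sizes differ, and
naturality of that map moves the cast outwards. -/
theorem tensorTupleMap_elem : {k : ℕ} → {c d : Fin k → Groth F} → (f : ∀ i, c i ⟶ d i) →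
    action F (finCongr (size_tensorTuple F fun i => (d i).base.size)) (tensorTupleMap f).elem =
      disjUnion F fun i => (f i).elem
  | 0, _, _, _ => action_one _
  | k + 1, c, d, f => by
      rw [disjUnion, ← tensorTupleMap_elem (fun i => f i.succ)]
      -- A trivial action is inserted on the first factor so that the cast of the second becomes the
      -- action of a sum of bijections.
      rw [← action_refl (f 0).elem, ← action_disjUnion₂, action_action,
        plus_refl_finCongr]
      rfl

theorem toOp_congr {k : ℕ} {n : Fin k → ℕ} {N : ℕ} (h : ∑ i, n i = N)
    {f : tensorTuple (fun i => (⟨⟨n i⟩⟩ : Groth F)) ⟶ ⟨⟨N⟩⟩} {σ : Perm (Fin N)} {g : F.obj ⟨N⟩}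
    (hb : ∀ i, f.base.toEquiv i = σ (Fin.cast ((size_tensorTuple F n).trans h) i))
    (he : f.elem = g) : f = toOp F h (σ, g) :=
  Groth.hom_ext (SymGpd.hom_ext hb) he

theorem id_eq_toOp (N : ℕ) :
    (networkOperad F).id N = toOp F (Fin.sum_univ_one _) (1, 1) :=
  toOp_congr _ (fun _ => rfl) rfl

theorem act_toOp {k : ℕ} {n : Fin k → ℕ} {N : ℕ} (hN : ∑ i, n i = N)
    (σ : Perm (Fin N)) (g : F.obj ⟨N⟩) (τ : Perm (Fin k)) :
    (networkOperad F).act (toOp F hN (σ, g)) τ =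
      toOp F (sum_perm hN τ) (σ * blockPerm hN τ, g) := by
  refine toOp_congr _ (fun i => congrArg σ (Fin.ext (permHom_val n τ i))) ?_
  refine (Groth.comp_elem _ _).trans ?_
  rw [permHom_elem, map_one, mul_one]
  rfl

theorem comp_toOp {k : ℕ} {n : Fin k → ℕ} {N : ℕ} (hN : ∑ i, n i = N)
    (σ : Perm (Fin N)) (g : F.obj ⟨N⟩)
    {j : Fin k → ℕ} {m : ∀ i, Fin (j i) → ℕ} (hn : ∀ i, ∑ q, m i q = n i)
    (τ : ∀ i, Perm (Fin (n i))) (x : ∀ i, F.obj ⟨n i⟩) :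
    (networkOperad F).comp (toOp F hN (σ, g)) (fun i => toOp F (hn i) (τ i, x i)) =
      toOp F (sum_flat hN hn)
        (σ * (finCongr hN).permCongr (blockSum τ),
          g * action F σ (action F (finCongr hN) (disjUnion F x))) := by
  let f : ∀ i, tensorTuple (fun q => (⟨⟨m i q⟩⟩ : Groth F)) ⟶ ⟨⟨n i⟩⟩ :=
    fun i => toOp F (hn i) (τ i, x i)
  refine toOp_congr _ (fun p => congrArg σ (Fin.ext ?_)) ?_
  · change ((tensorTupleMap f).base.toEquiv ((flatHom
      fun i q => (⟨⟨m i q⟩⟩ : Groth F)).base.toEquiv p)).val = _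
    -- Since `flatHom` preserves values, `p` may be replaced by an element `y` of the nested tensor
    -- product, which lies in a definite block.
    have hp := flatHom_val (fun i q => (⟨⟨m i q⟩⟩ : Groth F)) p
    generalize (flatHom fun i q => (⟨⟨m i q⟩⟩ : Groth F)).base.toEquiv p = y at hp
    obtain ⟨i, a, rfl⟩ := exists_tensorPos _ y
    rw [tensorTupleMap_tensorPos, tensorPos_val]
    refine (blockSum_val hN τ (a := Fin.cast ((size_tensorTuple F _).trans (hn i)) a) ?_).symm
    refine hp.symm.trans ((tensorPos_val
      (fun i => tensorTuple fun q => (⟨⟨m i q⟩⟩ : Groth F)) i a).trans ?_)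
    exact finSigmaFinEquiv_val_congr rfl
      (fun i => (size_tensorTuple F (m i)).trans (hn i)) rfl rfl
  · refine (Groth.comp_elem _ _).trans ?_
    rw [flatHom_elem, map_one, mul_one]
    refine (Groth.comp_elem _ _).trans (congrArg (g * ·) ?_)
    have := tensorTupleMap_elem f
    change _ = disjUnion F x at this
    rw [← this, action_action, action_action]
    rfl

theorem bijective_toOp {k : ℕ} (n : Fin k → ℕ) (N : ℕ) (h : ∑ i, n i = N) : Function.Bijective
    (toOp F h : Perm (Fin N) × F.obj ⟨N⟩ → (networkOperad F).Op n N) := by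
  constructor
  · rintro ⟨σ, g⟩ ⟨σ', g'⟩ h'
    have hb := congrArg (fun f : tensorTuple (fun i => (⟨⟨n i⟩⟩ : Groth F)) ⟶ ⟨⟨N⟩⟩ =>
      f.base.toEquiv) h'
    have he := congrArg (fun f : tensorTuple (fun i => (⟨⟨n i⟩⟩ : Groth F)) ⟶ ⟨⟨N⟩⟩ =>
      f.elem) h'
    exact Prod.ext (Equiv.ext fun i => Equiv.congr_fun hb
      (Fin.cast ((size_tensorTuple F n).trans h).symm i)) he
  · intro f
    let e : tensorTuple (fun i => (⟨⟨n i⟩⟩ : Groth F)) ⟶ ⟨⟨N⟩⟩ := f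
    exact ⟨((finCongr ((size_tensorTuple F n).trans h)).symm.trans e.base.toEquiv, e.elem), rfl⟩

theorem sum_eq_of_op {k : ℕ} {n : Fin k → ℕ} {N : ℕ} (f : (networkOperad F).Op n N) :
    ∑ i, n i = N := by
  have e : tensorTuple (fun i => (⟨⟨n i⟩⟩ : Groth F)) ⟶ ⟨⟨N⟩⟩ := f
  rw [← size_tensorTuple F n]
  exact (Fintype.card_fin _).symm.trans
    ((Fintype.card_congr e.base.toEquiv).trans (Fintype.card_fin _))

theorem exists_toOp {k : ℕ} {n : Fin k → ℕ} {N : ℕ} (f : (networkOperad F).Op n N) :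
    ∃ (h : ∑ i, n i = N) (σ : Perm (Fin N)) (g : F.obj ⟨N⟩), f = toOp F h (σ, g) := by
  obtain ⟨⟨σ, g⟩, h⟩ := (bijective_toOp n N (sum_eq_of_op f)).2 f
  exact ⟨_, σ, g, h.symm⟩

/-- Once the profiles are identified, the proofs of the size equations no longer matter. This
reduces each heterogeneous operad law to an equality of pairs. -/
theorem heq_toOp {k k' : ℕ} (hk : k = k') {n : Fin k → ℕ} {n' : Fin k' → ℕ}
    (hn : ∀ i, n i = n' (Fin.cast hk i)) {N : ℕ} (h : ∑ i, n i = N) (h' : ∑ i, n' i = N)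
    {x x' : Perm (Fin N) × F.obj ⟨N⟩} (hx : x = x') : HEq (toOp F h x) (toOp F h' x') := by
  subst hk hx
  obtain rfl : n = n' := funext hn
  rfl

end Formulas

/-! ### Disjoint unions and the operad laws -/

noncomputable section Laws

variable {F : SymGpd ⥤ MonCat.{u}}

theorem action_finCongr_rfl {n : ℕ} (g : F.obj ⟨n⟩) : action F (finCongr rfl) g = g :=
  action_refl g

theorem action_perm_mul {n : ℕ} (σ τ : Perm (Fin n)) (g : F.obj ⟨n⟩) :
    action F (σ * τ) g = action F σ (action F τ g) := (action_action τ σ g).symm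

/-- Networks of all sizes, which form a monoid under disjoint union. -/
structure Net (F : SymGpd ⥤ MonCat.{u}) : Type u where
  size : ℕ
  network : F.obj ⟨size⟩

/-- Equality of networks up to a cast becomes plain equality in `Net F`, so reassociation can be
done in an ordinary monoid. -/
theorem net_eq_iff {m n : ℕ} (h : m = n) (x : F.obj ⟨m⟩) (y : F.obj ⟨n⟩) :
    (⟨m, x⟩ : Net F) = ⟨n, y⟩ ↔ action F (finCongr h) x = y := by
  subst h
  rw [show finCongr (rfl : m = m) = Equiv.refl _ from rfl, action_refl]
  constructor
  · intro h
    cases h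
    rfl
  · rintro rfl
    rfl

variable [F.LaxBraided]

theorem disjUnion_one : {k : ℕ} → (n : Fin k → ℕ) →
    disjUnion F (fun i => (1 : F.obj ⟨n i⟩)) = 1
  | 0, _ => rfl
  | k + 1, n => by
      rw [disjUnion, disjUnion_one, disjUnion₂, lax_one]
      exact action_one _

theorem disjUnion_mul : {k : ℕ} → {n : Fin k → ℕ} → (x y : ∀ i, F.obj ⟨n i⟩) →
    disjUnion F (fun i => x i * y i) = disjUnion F x * disjUnion F y
  | 0, _, _, _ => (one_mul _).symm
  | k + 1, n, x, y => by
      rw [disjUnion, disjUnion_mul, disjUnion₂, lax_mul]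
      exact action_mul _ _ _

theorem action_blockSum : {k : ℕ} → {n : Fin k → ℕ} → (σ : ∀ i, Perm (Fin (n i))) →
    (x : ∀ i, F.obj ⟨n i⟩) →
    action F (blockSum σ) (disjUnion F x) = disjUnion F fun i => action F (σ i) (x i)
  | 0, _, _, _ => action_one _
  | k + 1, n, σ, x => by
      rw [disjUnion, disjUnion, ← action_blockSum, ← action_disjUnion₂, action_action,
        action_action]
      rfl

/-- This is where symmetry of the lax structure enters: naturality of `permHom` holds in the braided
category `Groth F`, and its network component is the claim. -/
theorem action_blockEquiv {k : ℕ} {n : Fin k → ℕ} (τ : Perm (Fin k)) (x : ∀ i, F.obj ⟨n i⟩) :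
    action F (blockEquiv n τ) (disjUnion F fun i => x (τ i)) = disjUnion F x := by
  -- With identity bijections, the morphisms `f i` carry exactly the networks `x i`.
  let f : ∀ i, (⟨⟨n i⟩⟩ : Groth F) ⟶ ⟨⟨n i⟩⟩ := fun i => (⟨𝟙 _, x i⟩ : Groth.Hom _ _)
  have h := congrArg (fun f : tensorTuple (fun i => (⟨⟨n (τ i)⟩⟩ : Groth F)) ⟶
    tensorTuple (fun i => (⟨⟨n i⟩⟩ : Groth F)) => f.elem) (permHom_natural f τ)
  simp only [Groth.comp_elem, permHom_elem, map_one, one_mul, mul_one] at h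
  have h₁ := tensorTupleMap_elem f
  have h₂ := tensorTupleMap_elem fun i => f (τ i)
  change _ = disjUnion F x at h₁
  change _ = disjUnion F fun i => x (τ i) at h₂
  rw [← h₁, ← h₂, ← h, action_action]
  refine Eq.trans ?_ (action_action _ _ _).symm
  refine congrArg (action F · _) (Equiv.ext fun i => Fin.ext ?_)
  exact (permHom_val n τ i).symm

instance : Monoid (Net F) where
  one := ⟨0, 1⟩
  mul x y := ⟨x.size + y.size, disjUnion₂ F x.network y.network⟩
  mul_assoc x y z := (net_eq_iff (Nat.add_assoc _ _ _) _ _).2 (lax_assoc x.network y.network z.network)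
  one_mul x := (net_eq_iff (Nat.zero_add _) _ _).2 (lax_unit_left x.network)
  mul_one x := (net_eq_iff (Nat.add_zero _) _ _).2 (lax_unit_right x.network)

theorem net_disjUnion : {k : ℕ} → {n : Fin k → ℕ} → (x : ∀ i, F.obj ⟨n i⟩) →
    (⟨_, disjUnion F x⟩ : Net F) = (List.ofFn fun i => (⟨n i, x i⟩ : Net F)).prod
  | 0, _, _ => rfl
  | k + 1, n, x => by
      rw [List.ofFn_succ, List.prod_cons, ← net_disjUnion, disjUnion]
      exact ((net_eq_iff (Fin.sum_univ_succ n).symm _ _).2 rfl).symm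

theorem prod_ofFn_flat {M : Type*} [Monoid M] {k : ℕ} {j : Fin k → ℕ} (b : ∀ i, Fin (j i) → M) :
    (List.ofFn (flat b)).prod = (List.ofFn fun i => (List.ofFn (b i)).prod).prod := by
  induction k with
  | zero => rfl
  | succ k ih =>
    rw [List.ofFn_succ, List.prod_cons, ← ih, ← List.prod_append, ← List.ofFn_fin_append,
      List.ofFn_congr (Fin.sum_univ_succ j)]
    congr 2
    funext p
    exact flat_succ b _

/-- In the monoid `Net F`, disjoint unions are products of lists, so this is general associativity.
-/
theorem disjUnion_flat {k : ℕ} {j : Fin k → ℕ} {m : ∀ i, Fin (j i) → ℕ}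
    (x : ∀ i q, F.obj ⟨m i q⟩) :
    action F (finCongr (sum_flat_eq m)) (disjUnion F (n := flat m)
      fun p => x (finSigmaFinEquiv.symm p).1 (finSigmaFinEquiv.symm p).2) =
      disjUnion F fun i => disjUnion F (x i) := by
  rw [← net_eq_iff]
  refine (net_disjUnion (n := flat m) fun p => x _ _).trans ?_
  refine Eq.trans (prod_ofFn_flat fun i q => (⟨m i q, x i q⟩ : Net F)) ?_
  rw [net_disjUnion]
  simp only [net_disjUnion]

theorem disjUnion_fin_one {N : ℕ} (g : F.obj ⟨N⟩) :
    action F (finCongr (Fin.sum_univ_one _)) (disjUnion F fun _ : Fin 1 => g) = g := by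
  rw [← net_eq_iff, net_disjUnion]
  simp

theorem blockSum_fin_one {N : ℕ} (σ : Perm (Fin N)) :
    (finCongr (Fin.sum_univ_one _)).permCongr (blockSum fun _ : Fin 1 => σ) = σ := by
  ext x
  have hz := finSigmaFinEquiv_zero_val (k := 0) (j := fun _ => N)
  exact (blockSum_val (Fin.sum_univ_one _) (fun _ : Fin 1 => σ) (hz x).symm).trans (hz (σ x))

theorem permCongr_finCongr_rfl {n : ℕ} (σ : Perm (Fin n)) : (finCongr rfl).permCongr σ = σ := rfl

theorem action_blockPerm {k : ℕ} {n : Fin k → ℕ} {N : ℕ} (h : ∑ i, n i = N) (τ : Perm (Fin k))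
    (x : ∀ i, F.obj ⟨n i⟩) :
    action F (blockPerm h τ) (action F (finCongr (sum_perm h τ)) (disjUnion F fun i => x (τ i))) =
      action F (finCongr h) (disjUnion F x) := by
  rw [← action_blockEquiv τ x, action_action, action_action]
  rfl

theorem flat_const_one {T : Type*} {k : ℕ} (c : Fin k → T) (p : Fin (∑ _ : Fin 1, k)) :
    flat (fun _ : Fin 1 => c) p = c (Fin.cast (Fin.sum_univ_one _) p) :=
  flat_eq (fun _ : Fin 1 => c) (i := 0) (finSigmaFinEquiv_zero_val (k := 0) (j := fun _ => k) _).symm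

theorem flat_singletons {T : Type*} {k : ℕ} (c : Fin k → T) (p : Fin (∑ _ : Fin k, 1)) :
    flat (fun i (_ : Fin 1) => c i) p = c (Fin.cast (by simp) p) := by
  refine flat_eq (fun i (_ : Fin 1) => c i) (q := 0) ?_
  rw [finSigmaFinEquiv_apply]
  simp

theorem flat_flat {T : Type*} {k : ℕ} {j : Fin k → ℕ} {l : ∀ i, Fin (j i) → ℕ}
    (a : ∀ i q, Fin (l i q) → T) (p : Fin (∑ p, flat l p)) :
    flat (j := flat l) (fun p => a (finSigmaFinEquiv.symm p).1 (finSigmaFinEquiv.symm p).2) p =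
      flat (fun i => flat (a i)) (Fin.cast (sum_flat_eq l) p) := by
  obtain ⟨⟨p, r⟩, rfl⟩ := finSigmaFinEquiv.surjective p
  refine (flat_apply _ p r).trans ?_
  refine Eq.trans ?_ (flat_eq (fun i => flat (a i)) (finSigmaFinEquiv_flat_val l p r)).symm
  exact (flat_apply (a (finSigmaFinEquiv.symm p).1) (finSigmaFinEquiv.symm p).2 r).symm

theorem isTypedOperad : (networkOperad F).IsTypedOperad where
  id_comp {k c N} f := by
    obtain ⟨h, σ, g, rfl⟩ := exists_toOp f
    rw [id_eq_toOp, comp_toOp]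
    refine heq_toOp (Fin.sum_univ_one _) (flat_const_one c) _ _ (congrArg₂ Prod.mk ?_ ?_)
    · rw [blockSum_fin_one, one_mul]
    · rw [disjUnion_fin_one, one_mul]
      exact action_refl g
  comp_id {k c N} f := by
    obtain ⟨h, σ, g, rfl⟩ := exists_toOp f
    simp only [id_eq_toOp]
    rw [comp_toOp]
    refine heq_toOp (by simp) (flat_singletons c) _ _ (congrArg₂ Prod.mk ?_ ?_)
    · subst h
      rw [blockSum_one]
      rfl
    · rw [disjUnion_one, action_one, action_one, mul_one]
  assoc {k c N j b l a} f g h := by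
    obtain ⟨hf, σ, x, rfl⟩ := exists_toOp f
    choose hg τ y hg' using fun i => exists_toOp (g i)
    choose hh ρ z hh' using fun i q => exists_toOp (h i q)
    obtain rfl : g = _ := funext hg'
    obtain rfl : h = _ := funext fun i => funext fun q => hh' i q
    -- Replacing every intermediate size by the sum it equals turns the casts of the composition
    -- formula into identities.
    obtain rfl : _ = b := funext fun i => funext (hh i)
    obtain rfl : _ = c := funext hg
    subst hf
    simp only [comp_toOp]
    refine HEq.trans (heq_of_eq (comp_toOp (n := flat fun i q => ∑ r, a i q r) _ _ _
      (fun p => hh _ _) (fun p => ρ _ _) (fun p => z _ _))) ?_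
    refine heq_toOp (sum_flat_eq l) (flat_flat a) _ _ (congrArg₂ Prod.mk ?_ ?_)
    · simp only [permCongr_finCongr_rfl]
      rw [blockSum_mul, mul_assoc]
      exact congrArg (fun π => σ * (blockSum τ * π)) (blockSum_flat ρ)
    · simp only [permCongr_finCongr_rfl, action_finCongr_rfl]
      -- The inner composites carry products of networks; splitting them leaves the innermost
      -- networks under the block sum of `τ`, where flattening applies.
      rw [disjUnion_mul, action_mul, ← action_blockSum, action_perm_mul, mul_assoc]
      exact congrArg (fun w => x * (action F σ _ * action F σ (action F (blockSum τ) w)))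
        (disjUnion_flat z)
  act_one f := by
    obtain ⟨h, σ, g, rfl⟩ := exists_toOp f
    rw [act_toOp, blockPerm_one, mul_one]
    rfl
  act_mul f ρ τ := by
    obtain ⟨h, σ, g, rfl⟩ := exists_toOp f
    rw [act_toOp, act_toOp, act_toOp, blockPerm_mul, mul_assoc]
    rfl
  act_comp {k c N j b} f g τ := by
    obtain ⟨hf, σ, x, rfl⟩ := exists_toOp f
    choose hg ρ y hg' using fun i => exists_toOp (g i)
    obtain rfl : g = _ := funext hg'
    rw [act_toOp, comp_toOp, comp_toOp, act_toOp]
    refine heq_toOp (sum_perm rfl τ)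
      (fun p => (flat_blockPerm b τ (Fin.cast (sum_perm rfl τ) p)).symm) _ _
      (congrArg₂ Prod.mk ?_ ?_)
    · rw [mul_assoc, mul_assoc, blockSum_blockPerm, blockPerm_blockPerm hf hg]
    · rw [action_perm_mul, action_blockPerm]
  comp_act {k c N j b} f g τ := by
    obtain ⟨hf, σ, x, rfl⟩ := exists_toOp f
    choose hg ρ y hg' using fun i => exists_toOp (g i)
    obtain rfl : g = _ := funext hg'
    simp only [act_toOp]
    rw [comp_toOp, comp_toOp, act_toOp]
    -- The action leaves networks unchanged, so the network components agree definitionally.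
    refine heq_toOp rfl (fun p => (flat_blockSum b τ p).symm) _ _ (congrArg₂ Prod.mk ?_ rfl)
    rw [mul_assoc, blockPerm_blockSum hf hg, blockSum_mul]
    rfl

end Laws

end NetworkOperad

theorem mainTheorem6 (F : SymGpd ⥤ MonCat.{u}) [F.LaxBraided] :
    (networkOperad F).IsTypedOperad ∧
    (∀ {k : ℕ} (n : Fin k → ℕ) (N : ℕ),
      (∀ h : ∑ i, n i = N, Function.Bijective
        (toOp F h : Equiv.Perm (Fin N) × F.obj ⟨N⟩ → (networkOperad F).Op n N)) ∧
      (∑ i, n i ≠ N → IsEmpty ((networkOperad F).Op n N))) ∧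
    (∀ {k : ℕ} {n : Fin k → ℕ} {N : ℕ} (hN : ∑ i, n i = N)
      (σ : Equiv.Perm (Fin N)) (g : F.obj ⟨N⟩)
      {j : Fin k → ℕ} {m : ∀ i, Fin (j i) → ℕ} (hn : ∀ i, ∑ q, m i q = n i)
      (τ : ∀ i, Equiv.Perm (Fin (n i))) (x : ∀ i, F.obj ⟨n i⟩),
      (networkOperad F).comp (toOp F hN (σ, g)) (fun i => toOp F (hn i) (τ i, x i)) =
        toOp F (sum_flat hN hn)
          (σ * (finCongr hN).permCongr (blockSum τ),
            g * action F σ (action F (finCongr hN) (disjUnion F x)))) ∧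
    (∀ N : ℕ, (networkOperad F).id N = toOp F (Fin.sum_univ_one _) (1, 1)) ∧
    (∀ {k : ℕ} {n : Fin k → ℕ} {N : ℕ} (hN : ∑ i, n i = N)
      (σ : Equiv.Perm (Fin N)) (g : F.obj ⟨N⟩) (τ : Equiv.Perm (Fin k)),
      (networkOperad F).act (toOp F hN (σ, g)) τ =
        toOp F (sum_perm hN τ) (σ * blockPerm hN τ, g)) := by
  refine ⟨isTypedOperad, fun n N => ⟨bijective_toOp n N, fun h => ⟨fun f => h (sum_eq_of_op f)⟩⟩,
    fun hN σ g _ _ hn τ x => comp_toOp hN σ g hn τ x, id_eq_toOp, fun hN σ g τ =>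
    act_toOp hN σ g τ⟩
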